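/- **Theorem (Disagreement coefficient).** *Definitions.* A function $f:\mathbb{R}^n\to[0,\infty)$ is $s$-concave ($s<0$) if $f(\lambda x+(1-\lambda)y)\ge(\lambda f(x)^s+(1-\lambda)f(y)^s)^{1/s}$ for all $x,y\in\mathbb{R}^n$ and $\lambda\in(0,1)$, where the right-hand side is read as $0$ if $f(x)=0$ or $f(y)=0$; for $s=0$ (log-concave) the right-hand side is $f(x)^\lambda f(y)^{1-\lambda}$. A probability distribution $\mathcal{D}$ on $\mathbb{R}^n$ is $s$-concave if it has an $s$-concave density, and isotropic if it has mean zero and identity covariance matrix. Homogeneous halfspaces are represented by nonzero normal vectors $w\in\mathbb{R}^n$. Put $d_{\mathcal{D}}(u,w)=\Pr_{x\sim\mathcal{D}}[(u\cdot x)(w\cdot x)<0]$, $\mathrm{ball}_{\mathcal{D}}(w,r)=\{u\ne 0: d_{\mathcal{D}}(u,w)\le r\}$, and $\mathrm{DIS}(H)=\{x:\exists u,v\in H,\ (u\cdot x)(v\cdot x)<0\}$. The disagreement coefficient of $w^*\neq 0$ at precision $\epsilon>0$ is $$\Theta_{w^*,\mathcal{D}}(\epsilon)=\sup_{r\ge\epsilon}\frac{\Pr_{\mathcal{D}}[\mathrm{DIS}(\mathrm{ball}_{\mathcal{D}}(w^*,r))]}{r}.$$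 For a fixed absolute constant $c>0$ let $$f_1(s,n)=c\,(2-2^{-3\alpha})^{-\frac1\alpha}\left[\left(\tfrac{1+\beta}{1+3\beta}\sqrt{3(1+\gamma)^{3/\gamma}}\,2^{1+1/\alpha}\right)^{\alpha}-1\right]^{-\frac1\alpha}(1+\gamma)^{-2/\gamma}\left(\tfrac{1+3\beta}{3+3\beta}\right)^2,$$ with $\alpha=\frac{s}{1+(n-2)s}$, $\beta=\frac{s}{1+(n-1)s}$, $\gamma=\frac{s}{1+ns}$, and let $$B(s,n,\epsilon)=\frac{\sqrt n\,(1+ns)^2}{s(1+(n+2)s)f_1(s,n)}\left(1-\epsilon^{\frac{s}{1+ns}}\right).$$ *Statement.* Let $c>0$. (1) For every $\epsilon_0\in(0,1)$ there is a constant $C>0$, depending only on $\epsilon_0$ and $c$, such that for all $n\ge1$, all $s$ with $-\frac{1}{2n+3}\le s<0$, every isotropic $s$-concave distribution $\mathcal{D}$ on $\mathbb{R}^n$, every $w^*\in\mathbb{R}^n\setminus\{0\}$ and every $0<\epsilon\le\epsilon_0$, $$\Theta_{w^*,\mathcal{D}}(\epsilon)\le C\,B(s,n,\epsilon),$$ and,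 for every isotropic log-concave distribution $\mathcal{D}$ on $\mathbb{R}^n$, every $w^*\neq0$ and every $0<\epsilon\le\epsilon_0$, $$\Theta_{w^*,\mathcal{D}}(\epsilon)\le C\sqrt n\,\log(1/\epsilon).$$ (2) There is a constant $K>0$ depending only on $c$ such that $\lim_{s\to0^-}B(s,n,\epsilon)=K\sqrt n\,\log(1/\epsilon)$ for all $n\ge1$ and $0<\epsilon<1$. -/

import Mathlib

open MeasureTheory Filter Topology
open scoped ENNReal

noncomputable section

/-- The weighted power mean `(l a ^ s + (1 - l) b ^ s) ^ (1 / s)` of `a, b ≥ 0`, with the convention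
that it vanishes as soon as `a = 0` or `b = 0`; for `s = 0` it is the weighted geometric mean. -/
def weightedPowerMean (s l a b : ℝ) : ℝ :=
  if a = 0 ∨ b = 0 then 0
  else if s = 0 then a ^ l * b ^ (1 - l)
  else (l * a ^ s + (1 - l) * b ^ s) ^ (1 / s)

/-- `f : ℝⁿ → ℝ₊` is `s`-concave (log-concave for `s = 0`). -/
def SConcaveFunction {n : ℕ} (s : ℝ) (f : EuclideanSpace ℝ (Fin n) → ℝ) : Prop :=
  (∀ x, 0 ≤ f x) ∧
    ∀ x y : EuclideanSpace ℝ (Fin n), ∀ l : ℝ, 0 < l → l < 1 →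
      weightedPowerMean s l (f x) (f y) ≤ f (l • x + (1 - l) • y)

/-- A distribution is `s`-concave if it has an `s`-concave density with respect to Lebesgue
measure. -/
def SConcaveDistribution {n : ℕ} (s : ℝ) (μ : Measure (EuclideanSpace ℝ (Fin n))) : Prop :=
  ∃ f : EuclideanSpace ℝ (Fin n) → ℝ, Measurable f ∧ SConcaveFunction s f ∧
    μ = (volume : Measure (EuclideanSpace ℝ (Fin n))).withDensity (fun x => ENNReal.ofReal (f x))

/-- A distribution is isotropic if it has finite second moments, mean zero, and identity
covariance matrix. -/
structure Isotropic {n : ℕ} (μ : Measure (EuclideanSpace ℝ (Fin n))) : Prop where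
  memLp : MemLp (fun x : EuclideanSpace ℝ (Fin n) => x) 2 μ
  mean : ∀ i : Fin n, ∫ x, x i ∂μ = 0
  covariance : ∀ i j : Fin n, ∫ x, x i * x j ∂μ = if i = j then 1 else 0

/-- `d_D(u, w) = Pr[(u ⬝ x)(w ⬝ x) < 0]`. -/
def halfspaceDist {n : ℕ} (μ : Measure (EuclideanSpace ℝ (Fin n)))
    (u w : EuclideanSpace ℝ (Fin n)) : ℝ :=
  μ.real {x | inner ℝ u x * inner ℝ w x < 0}

/-- The class of homogeneous halfspaces, each represented by a nonzero normal vector. -/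
def homogeneousHalfspaces (n : ℕ) : Set (EuclideanSpace ℝ (Fin n)) := {u | u ≠ 0}

/-- The homogeneous halfspaces `u` with `d_D(u, w) ≤ r`. -/
def halfspaceBall {n : ℕ} (μ : Measure (EuclideanSpace ℝ (Fin n)))
    (w : EuclideanSpace ℝ (Fin n)) (r : ℝ) : Set (EuclideanSpace ℝ (Fin n)) :=
  {u ∈ homogeneousHalfspaces n | halfspaceDist μ u w ≤ r}

/-- The disagreement region of a set of homogeneous halfspaces. -/
def disagreementRegion {n : ℕ} (H : Set (EuclideanSpace ℝ (Fin n))) :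
    Set (EuclideanSpace ℝ (Fin n)) :=
  {x | ∃ u ∈ H, ∃ v ∈ H, inner ℝ u x * inner ℝ v x < 0}

/-- The Alexander capacity at radius `r` (used for `r > 0`). -/
def alexanderCapacity {n : ℕ} (μ : Measure (EuclideanSpace ℝ (Fin n)))
    (w : EuclideanSpace ℝ (Fin n)) (r : ℝ) : ℝ≥0∞ :=
  μ (disagreementRegion (halfspaceBall μ w r)) / ENNReal.ofReal r

/-- The disagreement coefficient: the supremum of the capacity over all `r ≥ ε`, as an extended
nonnegative real. -/
def disagreementCoefficient {n : ℕ} (μ : Measure (EuclideanSpace ℝ (Fin n)))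
    (w : EuclideanSpace ℝ (Fin n)) (ε : ℝ) : ℝ≥0∞ :=
  ⨆ (r : ℝ) (_ : ε ≤ r), alexanderCapacity μ w r

/-- The function `f₁(s, n)`; `c` is the absolute constant in its definition. -/
def f₁ (c s : ℝ) (n : ℕ) : ℝ :=
  let α : ℝ := s / (1 + ((n : ℝ) - 2) * s)
  let β : ℝ := s / (1 + ((n : ℝ) - 1) * s)
  let γ : ℝ := s / (1 + (n : ℝ) * s)
  c * (2 - (2 : ℝ) ^ (-3 * α)) ^ (-(1 / α)) *
    (((1 + β) / (1 + 3 * β) * Real.sqrt (3 * (1 + γ) ^ (3 / γ)) * (2 : ℝ) ^ (1 + 1 / α)) ^ α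
      - 1) ^ (-(1 / α)) *
    (1 + γ) ^ (-(2 / γ)) * ((1 + 3 * β) / (3 + 3 * β)) ^ 2

/-- The quantity `√n (1 + n s)² / (s (1 + (n + 2) s) f₁(s, n)) · (1 - ε ^ (s / (1 + n s)))`. -/
def disagreementBound (c s : ℝ) (n : ℕ) (ε : ℝ) : ℝ :=
  Real.sqrt n * (1 + (n : ℝ) * s) ^ 2 / (s * (1 + ((n : ℝ) + 2) * s) * f₁ c s n) *
    (1 - ε ^ (s / (1 + (n : ℝ) * s)))

end

/-!
The disagreement coefficient of an isotropic `s`-concave distribution is bounded as follows.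

Write `s = -1 / p` and `D = p - n`. By the Borell–Brascamp–Lieb inequality
(`negPowerMean_lintegral_pi_le`, proved by induction on the dimension from the Brunn–Minkowski
inequality on the line), an `s`-concave distribution satisfies the Brunn–Minkowski inequality of
order `-1 / D`, and the condition `s ≥ -1 / (2 n + 3)` gives `D ≥ n + 3 ≥ 4`. Everything else is
derived from this inequality for measures of sets, which passes to all linear images at once, so no
marginal densities appear.

* Borell's lemma (`BrunnMinkowskiMeasure.seminorm_tail_le`): the mass of `‖x‖ > 2 t √n` is at most
  `(1 + t / (2 D)) ^ (-D)`, which is `ε` for `t` of order `D (ε ^ (-1 / D) - 1)`.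
* Since the order `-1 / D` may be weakened to `-1 / 4`, the remaining constants are universal.
  Halfspaces near the origin have mass bounded below (`Isotropic.measureReal_inner_gt_ge`), slabs
  `|⟪e, x⟫| ≤ b` have mass `O(b)` (`exists_slab_measureReal_le`), and thin double wedges have mass
  at least proportional to their angle (`exists_wedge_measureReal_ge`).
* By the last fact, a halfspace `u` with `d(u, w) ≤ r` makes an angle `O(r)` with `w`, so that
  `|⟪w, x⟫| = O(r ‖w‖ ‖x‖)` on the disagreement region of the ball of radius `r`
  (`exists_abs_inner_le_halfspaceDist`). The region is thus covered by `‖x‖ > 2 t √n`, of mass at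
  most `ε ≤ r`, and a slab of mass `O(r t √n)` (`exists_disagreementCoefficient_le`).

As `0 < f₁ ≤ c / 9` in the admissible range, the bound `O(√n D (ε ^ (-1 / D) - 1))` so obtained is
dominated by `disagreementBound` (`le_disagreementBound`). The limit `s → 0⁻` is elementary, and the
log-concave case follows from it, because a log-concave distribution is `s`-concave for all `s < 0`.
-/

open scoped NNReal

/-! ### Power means with negative exponent -/

/-- The weighted power mean of order `-1 / p` (with `0 < p`) of two extended nonnegative reals. The
conventions of `ℝ≥0∞` make it vanish as soon as one of the two arguments does. -/
noncomputable def negPowerMean (p : ℝ) (l m : ℝ≥0) (a b : ℝ≥0∞) : ℝ≥0∞ :=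
  (l * a ^ (-p⁻¹) + m * b ^ (-p⁻¹)) ^ (-p)

lemma ENNReal.rpow_le_rpow_of_nonpos {a b : ℝ≥0∞} {z : ℝ} (hz : z ≤ 0) (h : a ≤ b) :
    b ^ z ≤ a ^ z := by
  rw [← neg_neg z, ENNReal.rpow_neg b, ENNReal.rpow_neg a]
  exact ENNReal.inv_le_inv.2 (ENNReal.rpow_le_rpow h (by linarith))

lemma ENNReal.rpow_neg_inv_rpow_neg {p : ℝ} (hp : 0 < p) (a : ℝ≥0∞) : (a ^ (-p⁻¹)) ^ (-p) = a := by
  rw [← ENNReal.rpow_mul, neg_mul_neg, inv_mul_cancel₀ hp.ne', ENNReal.rpow_one]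

lemma negPowerMean_mono {p : ℝ} (hp : 0 < p) {l m : ℝ≥0} {a b a' b' : ℝ≥0∞} (ha : a ≤ a')
    (hb : b ≤ b') : negPowerMean p l m a b ≤ negPowerMean p l m a' b' := by
  have hp' : -p⁻¹ ≤ 0 := by have := inv_pos.2 hp; linarith
  unfold negPowerMean
  exact ENNReal.rpow_le_rpow_of_nonpos (by linarith) (add_le_add
    (mul_le_mul_right (ENNReal.rpow_le_rpow_of_nonpos hp' ha) _)
    (mul_le_mul_right (ENNReal.rpow_le_rpow_of_nonpos hp' hb) _))

lemma negPowerMean_zero_left {p : ℝ} (hp : 0 < p) {l m : ℝ≥0} (hl : l ≠ 0) (b : ℝ≥0∞) :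
    negPowerMean p l m 0 b = 0 := by
  have hp' : -p⁻¹ < 0 := by have := inv_pos.2 hp; linarith
  simp [negPowerMean, ENNReal.zero_rpow_of_neg hp', hl, hp]

lemma negPowerMean_zero_right {p : ℝ} (hp : 0 < p) {l m : ℝ≥0} (hm : m ≠ 0) (a : ℝ≥0∞) :
    negPowerMean p l m a 0 = 0 := by
  have hp' : -p⁻¹ < 0 := by have := inv_pos.2 hp; linarith
  simp [negPowerMean, ENNReal.zero_rpow_of_neg hp', hm, hp]

lemma negPowerMean_self {p : ℝ} (hp : 0 < p) {l m : ℝ≥0} (hlm : l + m = 1) (a : ℝ≥0∞) :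
    negPowerMean p l m a a = a := by
  have : (l : ℝ≥0∞) + m = 1 := by exact_mod_cast congrArg ((↑) : ℝ≥0 → ℝ≥0∞) hlm
  rw [negPowerMean, ← add_mul, this, one_mul, ENNReal.rpow_neg_inv_rpow_neg hp]

lemma le_negPowerMean {p : ℝ} (hp : 0 < p) {l m : ℝ≥0} (hlm : l + m = 1) {a b t : ℝ≥0∞}
    (ha : t ≤ a) (hb : t ≤ b) : t ≤ negPowerMean p l m a b :=
  (negPowerMean_self hp hlm t).ge.trans (negPowerMean_mono hp ha hb)

lemma negPowerMean_mul {p : ℝ} (hp : 0 < p) {l m : ℝ≥0} (a b : ℝ≥0∞) {t : ℝ≥0∞} (ht : t ≠ 0)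
    (ht' : t ≠ ∞) : negPowerMean p l m (t * a) (t * b) = t * negPowerMean p l m a b := by
  have h0 : t ^ (-p⁻¹) ≠ 0 := by simp [ENNReal.rpow_eq_zero_iff, ht, ht']
  have h1 : t ^ (-p⁻¹) ≠ ∞ := by simp [ENNReal.rpow_eq_top_iff, ht, ht']
  have key : ∀ c : ℝ≥0∞, (t * c) ^ (-p⁻¹) = t ^ (-p⁻¹) * c ^ (-p⁻¹) := fun c => by
    rcases eq_or_ne c 0 with rfl | hc
    · have hp' : -p⁻¹ < 0 := by have := inv_pos.2 hp; linarith
      simp [ENNReal.zero_rpow_of_neg hp', ENNReal.mul_top h0]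
    · exact ENNReal.mul_rpow_of_ne_zero ht hc _
  have key' : ∀ c : ℝ≥0∞, (t ^ (-p⁻¹) * c) ^ (-p) = t * c ^ (-p) := fun c => by
    rcases eq_or_ne c 0 with rfl | hc
    · have hp' : -p < 0 := by linarith
      simp [ENNReal.zero_rpow_of_neg hp', ENNReal.mul_top ht]
    · rw [ENNReal.mul_rpow_of_ne_zero h0 hc, ENNReal.rpow_neg_inv_rpow_neg hp]
  rw [negPowerMean, key, key, negPowerMean, ← key']
  congr 1
  ring

/-- Power means increase with their order, and `-1 / p` increases with `p`. -/
lemma negPowerMean_le_of_le {p q : ℝ} (hp : 0 < p) (hpq : p ≤ q) {l m : ℝ≥0} (hlm : l + m = 1)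
    (a b : ℝ≥0∞) : negPowerMean p l m a b ≤ negPowerMean q l m a b := by
  have hq : 0 < q := hp.trans_le hpq
  have hlm' : (l : ℝ≥0∞) + m = 1 := by exact_mod_cast congrArg ((↑) : ℝ≥0 → ℝ≥0∞) hlm
  have h := ENNReal.rpow_arith_mean_le_arith_mean2_rpow l m (a ^ (-q⁻¹)) (b ^ (-q⁻¹)) hlm'
    (p := q / p) ((one_le_div hp).2 hpq)
  have e : -q⁻¹ * (q / p) = -p⁻¹ := by field_simp
  rw [← ENNReal.rpow_mul, ← ENNReal.rpow_mul, e] at h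
  have h2 := ENNReal.rpow_le_rpow_of_nonpos (z := -p) (by linarith) h
  rw [← ENNReal.rpow_mul] at h2
  have e2 : q / p * -p = -q := by field_simp
  rwa [e2] at h2

/-- Hölder's inequality for power means: the mean of order `-1 / (p - 1)` of a product is at most the
mean of order `-1 / p` of one factor times the arithmetic mean of the other. -/
lemma negPowerMean_mul_le {p : ℝ} (hp : 1 < p) {l m : ℝ≥0} (hl : l ≠ 0) (hm : m ≠ 0)
    {a b : ℝ≥0∞} (ha : a ≠ 0) (hb : b ≠ 0) (ha' : a ≠ ∞) (hb' : b ≠ ∞) (P Q : ℝ≥0∞) :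
    negPowerMean (p - 1) l m (a * P) (b * Q) ≤ negPowerMean p l m a b * (l * P + m * Q) := by
  have hp0 : 0 < p := by linarith
  have hp1 : 0 < p - 1 := by linarith
  rcases eq_or_ne P 0 with rfl | hP
  · simp [negPowerMean_zero_left hp1 hl]
  rcases eq_or_ne Q 0 with rfl | hQ
  · simp [negPowerMean_zero_right hp1 hm]
  set S : ℝ≥0∞ := l * a ^ (-p⁻¹) + m * b ^ (-p⁻¹) with hS
  have hS0 : S ≠ 0 := by
    simp [hS, hl, ENNReal.rpow_eq_zero_iff, ha, ha']
  have hST : S ≠ ∞ := by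
    have h1 : a ^ (-p⁻¹) ≠ ∞ := by simp [ENNReal.rpow_eq_top_iff, ha, ha']
    have h2 : b ^ (-p⁻¹) ≠ ∞ := by simp [ENNReal.rpow_eq_top_iff, hb, hb']
    finiteness
  have hSp : S ^ (-p) ≠ 0 := by simp [ENNReal.rpow_eq_zero_iff, hS0, hST]
  rcases eq_or_ne P ∞ with rfl | hP'
  · have : (l : ℝ≥0∞) * ∞ = ∞ := ENNReal.mul_top (by simpa using hl)
    have hSe : negPowerMean p l m a b = S ^ (-p) := rfl
    rw [hSe, this, top_add, ENNReal.mul_top hSp]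
    exact le_top
  rcases eq_or_ne Q ∞ with rfl | hQ'
  · have : (m : ℝ≥0∞) * ∞ = ∞ := ENNReal.mul_top (by simpa using hm)
    have hSe : negPowerMean p l m a b = S ^ (-p) := rfl
    rw [hSe, this, add_top, ENNReal.mul_top hSp]
    exact le_top
  have hq : 1 ≤ p / (p - 1) := by rw [one_le_div hp1]; linarith
  have H := ENNReal.inner_le_weight_mul_Lp_of_nonneg Finset.univ hq
    ![(l : ℝ≥0∞) * P, m * Q] ![a ^ (-p⁻¹) / P, b ^ (-p⁻¹) / Q]
  simp only [Fin.sum_univ_two, Matrix.cons_val_zero, Matrix.cons_val_one] at H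
  have e1 : ∀ (k : ℝ≥0) (c R : ℝ≥0∞), R ≠ 0 → R ≠ ∞ → (k : ℝ≥0∞) * R * (c / R) = k * c := by
    intro k c R h0 h1
    rw [mul_assoc, ENNReal.mul_div_cancel h0 h1]
  have e2 : ∀ (k : ℝ≥0) (c R : ℝ≥0∞), c ≠ 0 → c ≠ ∞ → R ≠ 0 → R ≠ ∞ →
      (k : ℝ≥0∞) * R * (c ^ (-p⁻¹) / R) ^ (p / (p - 1)) = k * (c * R) ^ (-(p - 1)⁻¹) := by
    intro k c R hc0 hc1 h0 h1
    have hc : c ^ (-p⁻¹) ≠ 0 := by simp [ENNReal.rpow_eq_zero_iff, hc0, hc1]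
    rw [mul_assoc, div_eq_mul_inv, ENNReal.mul_rpow_of_ne_zero hc (by simpa using h1),
      ENNReal.mul_rpow_of_ne_zero hc0 h0, ← ENNReal.rpow_mul, ← ENNReal.rpow_neg_one,
      ← ENNReal.rpow_mul]
    have e3 : -p⁻¹ * (p / (p - 1)) = -(p - 1)⁻¹ := by field_simp
    have e4 : R * R ^ (-1 * (p / (p - 1))) = R ^ (-(p - 1)⁻¹) := by
      conv_lhs => rw [← ENNReal.rpow_one R, ← ENNReal.rpow_mul, ← ENNReal.rpow_add _ _ h0 h1]
      congr 1
      field_simp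
      ring
    rw [e3, ← e4]
    ring
  rw [e1 _ _ _ hP hP', e1 _ _ _ hQ hQ', e2 _ _ _ ha ha' hP hP', e2 _ _ _ hb hb' hQ hQ', ← hS] at H
  set W : ℝ≥0∞ := l * P + m * Q with hW
  set U : ℝ≥0∞ := l * (a * P) ^ (-(p - 1)⁻¹) + m * (b * Q) ^ (-(p - 1)⁻¹) with hU
  have f1 : 1 - (p / (p - 1))⁻¹ = p⁻¹ := by field_simp; ring
  rw [f1] at H
  have H2 := ENNReal.rpow_le_rpow H hp0.le
  rw [ENNReal.mul_rpow_of_nonneg _ _ hp0.le, ← ENNReal.rpow_mul, ← ENNReal.rpow_mul,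
    inv_mul_cancel₀ hp0.ne', ENNReal.rpow_one] at H2
  have f2 : (p / (p - 1))⁻¹ * p = p - 1 := by field_simp
  rw [f2] at H2
  have hSpp : S ^ p ≠ ∞ := by simp [ENNReal.rpow_eq_top_iff, hS0, hST]
  have hSp0 : S ^ p ≠ 0 := by simp [ENNReal.rpow_eq_zero_iff, hS0, hST]
  have hPa : a * P ≠ 0 ∧ a * P ≠ ∞ := ⟨mul_ne_zero ha hP, ENNReal.mul_ne_top ha' hP'⟩
  have hQb : b * Q ≠ 0 ∧ b * Q ≠ ∞ := ⟨mul_ne_zero hb hQ, ENNReal.mul_ne_top hb' hQ'⟩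
  have hU0 : U ≠ 0 := by simp [hU, hl, ENNReal.rpow_eq_zero_iff, hPa]
  have hUT : U ≠ ∞ := by
    have h1 : (a * P) ^ (-(p - 1)⁻¹) ≠ ∞ := by simp [ENNReal.rpow_eq_top_iff, ha, hP, hPa.2]
    have h2 : (b * Q) ^ (-(p - 1)⁻¹) ≠ ∞ := by simp [ENNReal.rpow_eq_top_iff, hb, hQ, hQb.2]
    finiteness
  have hUp : U ^ (p - 1) ≠ ∞ := by simp [ENNReal.rpow_eq_top_iff, hU0, hUT]
  have hUp0 : U ^ (p - 1) ≠ 0 := by simp [ENNReal.rpow_eq_zero_iff, hU0, hUT]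
  rw [negPowerMean, negPowerMean, ← hS, ← hU, ENNReal.rpow_neg, ENNReal.rpow_neg, mul_comm,
    ← div_eq_mul_inv, ENNReal.le_div_iff_mul_le (Or.inl hSp0) (Or.inl hSpp), mul_comm,
    ← div_eq_mul_inv]
  exact ENNReal.div_le_of_le_mul H2

lemma continuous_negPowerMean (p : ℝ) (l m : ℝ≥0) :
    Continuous fun x : ℝ≥0∞ × ℝ≥0∞ => negPowerMean p l m x.1 x.2 := by
  unfold negPowerMean
  refine ENNReal.continuous_rpow_const.comp (Continuous.add ?_ ?_)
  · exact (ENNReal.continuous_const_mul (by simp)).comp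
      (ENNReal.continuous_rpow_const.comp continuous_fst)
  · exact (ENNReal.continuous_const_mul (by simp)).comp
      (ENNReal.continuous_rpow_const.comp continuous_snd)

/-! ### The Brunn–Minkowski inequality on the line -/

/-- For compact `K` and `L`, the translates `K + min L` and `max K + L` lie in `K + L` and meet in
one point. -/
lemma volume_add_le_of_isCompact {K L C : Set ℝ} (hK : IsCompact K) (hL : IsCompact L)
    (hK0 : K.Nonempty) (hL0 : L.Nonempty) (h : ∀ x ∈ K, ∀ y ∈ L, x + y ∈ C) :
    volume K + volume L ≤ volume C := by
  obtain ⟨k, hk, hkm⟩ := hK.exists_isGreatest hK0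
  obtain ⟨y, hy, hym⟩ := hL.exists_isLeast hL0
  have h1 : volume ((fun x => x + y) '' K) = volume K := by
    rw [Set.image_add_right, measure_preimage_add_right]
  have h2 : volume ((fun x => k + x) '' L) = volume L := by
    rw [Set.image_add_left, measure_preimage_add]
  have hd : AEDisjoint volume ((fun x => x + y) '' K) ((fun x => k + x) '' L) := by
    refine measure_mono_null (t := {k + y}) ?_ (by simp)
    rintro z ⟨⟨a, ha, rfl⟩, ⟨b, hb, hab⟩⟩
    have := hkm ha
    have := hym hb
    simp only at hab
    simp only [Set.mem_singleton_iff]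
    linarith
  have hm : MeasurableSet ((fun x => k + x) '' L) :=
    (hL.image (continuous_const.add continuous_id)).measurableSet
  rw [← h1, ← h2, ← measure_union₀ hm.nullMeasurableSet hd]
  refine measure_mono ?_
  rintro z (⟨a, ha, rfl⟩ | ⟨b, hb, rfl⟩)
  · exact h a ha y hy
  · exact h k hk b hb

lemma volume_add_le {A B C : Set ℝ} (hA : MeasurableSet A) (hB : MeasurableSet B)
    (hA0 : A.Nonempty) (hB0 : B.Nonempty) (h : ∀ x ∈ A, ∀ y ∈ B, x + y ∈ C) :
    volume A + volume B ≤ volume C := by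
  obtain ⟨a, ha⟩ := hA0
  obtain ⟨b, hb⟩ := hB0
  have hA' : ∀ r < volume A, ∃ K ⊆ A, IsCompact K ∧ K.Nonempty ∧ r ≤ volume K := fun r hr => by
    obtain ⟨K, hKA, hK, hr⟩ := hA.exists_lt_isCompact hr
    exact ⟨K, hKA, hK, nonempty_of_measure_ne_zero (bot_lt_iff_ne_bot.1 (bot_le.trans_lt hr)),
      hr.le⟩
  have hB' : ∀ r < volume B, ∃ K ⊆ B, IsCompact K ∧ K.Nonempty ∧ r ≤ volume K := fun r hr => by
    obtain ⟨K, hKA, hK, hr⟩ := hB.exists_lt_isCompact hr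
    exact ⟨K, hKA, hK, nonempty_of_measure_ne_zero (bot_lt_iff_ne_bot.1 (bot_le.trans_lt hr)),
      hr.le⟩
  rcases eq_or_ne (volume A) 0 with h0 | h0
  · rw [h0, zero_add, ← measure_preimage_add volume (-a) B]
    refine measure_mono fun x hx => ?_
    simpa using h a ha _ hx
  rcases eq_or_ne (volume B) 0 with h0' | h0'
  · rw [h0', add_zero, ← measure_preimage_add_right volume (-b) A]
    refine measure_mono fun x hx => ?_
    simpa using h _ hx b hb
  by_contra! hlt
  obtain ⟨r, hr, t, ht, hrt⟩ := ENNReal.exists_lt_add_of_lt_add hlt h0 h0'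
  refine hrt.not_ge ?_
  obtain ⟨K, hKA, hK, hK0, hr⟩ := hA' r hr
  obtain ⟨L, hLB, hL, hL0, ht⟩ := hB' t ht
  exact (add_le_add hr ht).trans (volume_add_le_of_isCompact hK hL hK0 hL0
    fun x hx y hy => h x (hKA hx) y (hLB hy))

lemma volume_weighted_add_le {l m : ℝ≥0} (hl : l ≠ 0) (hm : m ≠ 0) {A B C : Set ℝ}
    (hA : MeasurableSet A) (hB : MeasurableSet B) (hA0 : A.Nonempty) (hB0 : B.Nonempty)
    (h : ∀ x ∈ A, ∀ y ∈ B, (l : ℝ) * x + m * y ∈ C) :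
    l * volume A + m * volume B ≤ volume C := by
  have key : ∀ (k : ℝ≥0), k ≠ 0 → ∀ S : Set ℝ,
      volume ((fun x => (k : ℝ)⁻¹ * x) ⁻¹' S) = k * volume S := fun k hk S => by
    rw [Real.volume_preimage_mul_left (by simpa using hk), inv_inv, NNReal.abs_eq,
      ENNReal.ofReal_coe_nnreal]
  have hl' : (l : ℝ) ≠ 0 := by simpa using hl
  have hm' : (m : ℝ) ≠ 0 := by simpa using hm
  rw [← key l hl, ← key m hm]
  refine volume_add_le ((measurable_const_mul _) hA) ((measurable_const_mul _) hB) ?_ ?_ ?_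
  · obtain ⟨a, ha⟩ := hA0
    exact ⟨l * a, by simpa [hl] using ha⟩
  · obtain ⟨a, ha⟩ := hB0
    exact ⟨m * a, by simpa [hm] using ha⟩
  · intro x hx y hy
    have := h _ hx _ hy
    rwa [mul_inv_cancel_left₀ hl', mul_inv_cancel_left₀ hm'] at this

/-! ### The Borell–Brascamp–Lieb inequality -/

/-- The layer cake formula for functions which may take the value `∞`. -/
lemma lintegral_eq_lintegral_meas_ofReal_le {H : ℝ → ℝ≥0∞} (hH : Measurable H) :
    ∫⁻ x, H x = ∫⁻ t in Set.Ioi (0 : ℝ), volume {x | ENNReal.ofReal t ≤ H x} := by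
  have h1 : ∀ x, H x = ∫⁻ t in Set.Ioi (0 : ℝ),
      {q : ℝ × ℝ | ENNReal.ofReal q.2 ≤ H q.1}.indicator (1 : ℝ × ℝ → ℝ≥0∞) (x, t) := by
    intro x
    have hm : MeasurableSet {t : ℝ | ENNReal.ofReal t ≤ H x} :=
      measurableSet_le ENNReal.measurable_ofReal measurable_const
    have : (fun t => {q : ℝ × ℝ | ENNReal.ofReal q.2 ≤ H q.1}.indicator (1 : ℝ × ℝ → ℝ≥0∞) (x, t)) =
        {t : ℝ | ENNReal.ofReal t ≤ H x}.indicator 1 := by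
      ext t
      simp [Set.indicator]
    rw [this, lintegral_indicator_one hm, Measure.restrict_apply hm]
    rcases eq_or_ne (H x) ∞ with hx | hx
    · simp [hx]
    · have : {t : ℝ | ENNReal.ofReal t ≤ H x} ∩ Set.Ioi 0 = Set.Ioc 0 (H x).toReal := by
        ext t
        simp only [Set.mem_inter_iff, Set.mem_ofPred_eq, Set.mem_Ioi, Set.mem_Ioc]
        rw [and_comm, ENNReal.ofReal_le_iff_le_toReal hx]
      rw [this, Real.volume_Ioc, sub_zero, ENNReal.ofReal_toReal hx]
  have hS : MeasurableSet {q : ℝ × ℝ | ENNReal.ofReal q.2 ≤ H q.1} :=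
    measurableSet_le (ENNReal.measurable_ofReal.comp measurable_snd) (hH.comp measurable_fst)
  calc ∫⁻ x, H x = ∫⁻ x, ∫⁻ t in Set.Ioi (0 : ℝ),
        {q : ℝ × ℝ | ENNReal.ofReal q.2 ≤ H q.1}.indicator (1 : ℝ × ℝ → ℝ≥0∞) (x, t) :=
        lintegral_congr h1
    _ = ∫⁻ t in Set.Ioi (0 : ℝ), ∫⁻ x,
        {q : ℝ × ℝ | ENNReal.ofReal q.2 ≤ H q.1}.indicator (1 : ℝ × ℝ → ℝ≥0∞) (x, t) := by
        rw [lintegral_lintegral_swap]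
        exact (measurable_one.indicator hS).aemeasurable
    _ = _ := by
        refine lintegral_congr fun t => ?_
        have hm : MeasurableSet {x : ℝ | ENNReal.ofReal t ≤ H x} :=
          measurableSet_le measurable_const hH
        rw [← lintegral_indicator_one hm]
        rfl

/-- The one-dimensional inequality for functions with supremum `1`: the superlevel sets satisfy the
Brunn–Minkowski inequality at every height below `1`. -/
lemma lintegral_add_le_of_superlevel {l m : ℝ≥0} (hl : l ≠ 0) (hm : m ≠ 0) {F G H : ℝ → ℝ≥0∞}
    (hF : Measurable F) (hG : Measurable G) (hH : Measurable H) (hF1 : ∀ x, F x ≤ 1)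
    (hG1 : ∀ x, G x ≤ 1) (hF' : ∀ t < 1, ∃ x, t ≤ F x) (hG' : ∀ t < 1, ∃ x, t ≤ G x)
    (h : ∀ x y t, t ≤ F x → t ≤ G y → t ≤ H (l * x + m * y)) :
    l * (∫⁻ x, F x) + m * (∫⁻ x, G x) ≤ ∫⁻ x, H x := by
  have hmeas : ∀ {K : ℝ → ℝ≥0∞}, Measurable fun t : ℝ => volume {x | ENNReal.ofReal t ≤ K x} :=
    fun {K} => by
      refine Antitone.measurable fun s t hst => measure_mono fun x hx => ?_
      exact (ENNReal.ofReal_le_ofReal hst).trans hx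
  rw [lintegral_eq_lintegral_meas_ofReal_le hF, lintegral_eq_lintegral_meas_ofReal_le hG,
    lintegral_eq_lintegral_meas_ofReal_le hH, ← lintegral_const_mul _ hmeas,
    ← lintegral_const_mul _ hmeas, ← lintegral_add_left (hmeas.const_mul _)]
  refine lintegral_mono_ae ?_
  have h1 : ∀ᵐ t : ℝ, t ≠ 1 := by simp [ae_iff]
  filter_upwards [ae_restrict_of_ae h1] with t ht
  rcases lt_or_gt_of_ne ht with ht | ht
  · have ht1 : ENNReal.ofReal t < 1 := by simpa using ht
    exact volume_weighted_add_le hl hm (measurableSet_le measurable_const hF)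
      (measurableSet_le measurable_const hG) (hF' _ ht1) (hG' _ ht1)
      fun x hx y hy => h x y _ hx hy
  · have ht1 : 1 < ENNReal.ofReal t := by simpa using ht
    have e1 : {x | ENNReal.ofReal t ≤ F x} = ∅ := by
      ext x; simpa using (hF1 x).trans_lt ht1
    have e2 : {x | ENNReal.ofReal t ≤ G x} = ∅ := by
      ext x; simpa using (hG1 x).trans_lt ht1
    simp [e1, e2]

/-- For bounded functions, dividing each by its supremum `a`, `b` and `H` by the mean of `a` and `b`
reduces the inequality to the normalized one; Hölder's inequality recombines the factors. -/
lemma negPowerMean_lintegral_le_of_bounded {p : ℝ} (hp : 1 < p) {l m : ℝ≥0} (hl : l ≠ 0)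
    (hm : m ≠ 0) (hlm : l + m = 1) {F G H : ℝ → ℝ≥0∞}
    (hF : Measurable F) (hG : Measurable G) (hH : Measurable H) {N : ℝ≥0∞} (hN : N ≠ ∞)
    (hFN : ∀ x, F x ≤ N) (hGN : ∀ x, G x ≤ N)
    (h : ∀ x y, negPowerMean p l m (F x) (G y) ≤ H (l * x + m * y)) :
    negPowerMean (p - 1) l m (∫⁻ x, F x) (∫⁻ x, G x) ≤ ∫⁻ x, H x := by
  have hp0 : 0 < p := by linarith
  have hp1 : 0 < p - 1 := by linarith
  set a := ⨆ x, F x with ha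
  set b := ⨆ x, G x with hb
  have ha' : a ≠ ∞ := ne_top_of_le_ne_top hN (iSup_le hFN)
  have hb' : b ≠ ∞ := ne_top_of_le_ne_top hN (iSup_le hGN)
  rcases eq_or_ne a 0 with ha0 | ha0
  · have : ∀ x, F x = 0 := fun x =>
      nonpos_iff_eq_zero.1 ((le_iSup F x).trans ha0.le)
    simp [this, negPowerMean_zero_left hp1 hl]
  rcases eq_or_ne b 0 with hb0 | hb0
  · have : ∀ x, G x = 0 := fun x =>
      nonpos_iff_eq_zero.1 ((le_iSup G x).trans hb0.le)
    simp [this, negPowerMean_zero_right hp1 hm]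
  set M := negPowerMean p l m a b with hM
  have hM0 : M ≠ 0 := by
    have h1 : min a b ≤ M := le_negPowerMean hp0 hlm (min_le_left _ _) (min_le_right _ _)
    have h2 : 0 < min a b := lt_min (pos_iff_ne_zero.2 ha0) (pos_iff_ne_zero.2 hb0)
    exact (h2.trans_le h1).ne'
  have hM1 : M ≠ ∞ := by
    have h1 : M ≤ max a b := (negPowerMean_mono hp0 (le_max_left _ _) (le_max_right _ _)).trans
      (negPowerMean_self hp0 hlm _).le
    exact ne_top_of_le_ne_top (by simp [ha', hb']) h1
  have key := lintegral_add_le_of_superlevel hl hm (hF.const_mul a⁻¹) (hG.const_mul b⁻¹)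
    (hH.const_mul M⁻¹) ?_ ?_ ?_ ?_ ?_
  · rw [lintegral_const_mul _ hF, lintegral_const_mul _ hG, lintegral_const_mul _ hH] at key
    have h1 := negPowerMean_mul_le hp hl hm ha0 hb0 ha' hb' (a⁻¹ * ∫⁻ x, F x) (b⁻¹ * ∫⁻ x, G x)
    rw [ENNReal.mul_inv_cancel_left ha0 ha', ENNReal.mul_inv_cancel_left hb0 hb'] at h1
    refine h1.trans ((mul_le_mul_right key _).trans ?_)
    rw [← hM, ENNReal.mul_inv_cancel_left hM0 hM1]
  · intro x
    rw [mul_comm, ← div_eq_mul_inv]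
    exact ENNReal.div_le_of_le_mul (by simpa using le_iSup F x)
  · intro x
    rw [mul_comm, ← div_eq_mul_inv]
    exact ENNReal.div_le_of_le_mul (by simpa using le_iSup G x)
  · intro t ht
    have : a * t < a := by simpa using ENNReal.mul_lt_mul_right ha0 ha' ht
    obtain ⟨x, hx⟩ := lt_iSup_iff.1 this
    refine ⟨x, ?_⟩
    rw [mul_comm, ← div_eq_mul_inv, ENNReal.le_div_iff_mul_le (Or.inl ha0) (Or.inl ha'), mul_comm]
    exact hx.le
  · intro t ht
    have : b * t < b := by simpa using ENNReal.mul_lt_mul_right hb0 hb' ht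
    obtain ⟨x, hx⟩ := lt_iSup_iff.1 this
    refine ⟨x, ?_⟩
    rw [mul_comm, ← div_eq_mul_inv, ENNReal.le_div_iff_mul_le (Or.inl hb0) (Or.inl hb'), mul_comm]
    exact hx.le
  · intro x y t hx hy
    rcases eq_or_ne t 0 with rfl | ht0
    · simp
    have hx' : t * a ≤ F x := by
      rwa [mul_comm, ← div_eq_mul_inv, ENNReal.le_div_iff_mul_le (Or.inl ha0) (Or.inl ha')] at hx
    have hy' : t * b ≤ G y := by
      rwa [mul_comm, ← div_eq_mul_inv, ENNReal.le_div_iff_mul_le (Or.inl hb0) (Or.inl hb')] at hy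
    have ht1 : t ≠ ∞ := by
      rintro rfl
      rw [ENNReal.top_mul ha0] at hx'
      exact hN (top_le_iff.1 (hx'.trans (hFN x)))
    rw [mul_comm, ← div_eq_mul_inv, ENNReal.le_div_iff_mul_le (Or.inl hM0) (Or.inl hM1), hM,
      ← negPowerMean_mul hp0 a b ht0 ht1]
    exact (negPowerMean_mono hp0 hx' hy').trans (h x y)

/-- The one-dimensional Borell–Brascamp–Lieb inequality, by truncation from the bounded case. -/
theorem negPowerMean_lintegral_le {p : ℝ} (hp : 1 < p) {l m : ℝ≥0} (hl : l ≠ 0)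
    (hm : m ≠ 0) (hlm : l + m = 1) {F G H : ℝ → ℝ≥0∞}
    (hF : Measurable F) (hG : Measurable G) (hH : Measurable H)
    (h : ∀ x y, negPowerMean p l m (F x) (G y) ≤ H (l * x + m * y)) :
    negPowerMean (p - 1) l m (∫⁻ x, F x) (∫⁻ x, G x) ≤ ∫⁻ x, H x := by
  have hlim : ∀ K : ℝ → ℝ≥0∞, Measurable K →
      Tendsto (fun N : ℕ => ∫⁻ x, min (K x) N) atTop (𝓝 (∫⁻ x, K x)) := by
    intro K hK
    refine lintegral_tendsto_of_tendsto_of_monotone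
      (fun N => (hK.min measurable_const).aemeasurable) ?_ ?_
    · refine Eventually.of_forall fun x i j hij => ?_
      exact min_le_min_left _ (by exact_mod_cast hij)
    · refine Eventually.of_forall fun x => ?_
      have := (continuous_const.min continuous_id : Continuous fun N : ℝ≥0∞ => min (K x) N).tendsto ∞
      rw [min_eq_left le_top] at this
      exact this.comp ENNReal.tendsto_nat_nhds_top
  refine le_of_tendsto (((continuous_negPowerMean (p - 1) l m).tendsto _).comp
    ((hlim F hF).prodMk_nhds (hlim G hG))) (Eventually.of_forall fun N => ?_)
  refine negPowerMean_lintegral_le_of_bounded hp hl hm hlm (hF.min measurable_const)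
    (hG.min measurable_const) hH (N := N) (by simp) (fun x => min_le_right _ _)
    (fun x => min_le_right _ _) fun x y => ?_
  exact (negPowerMean_mono (by linarith) (min_le_left _ _) (min_le_left _ _)).trans (h x y)

/-- The Borell–Brascamp–Lieb inequality: in dimension `n`, the order `-1 / p` of the pointwise
hypothesis becomes `-1 / (p - n)` for the integrals. -/
theorem negPowerMean_lintegral_pi_le {l m : ℝ≥0} (hl : l ≠ 0) (hm : m ≠ 0) (hlm : l + m = 1)
    (n : ℕ) {p : ℝ} (hp : n < p) {F G H : (Fin n → ℝ) → ℝ≥0∞}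
    (hF : Measurable F) (hG : Measurable G) (hH : Measurable H)
    (h : ∀ x y, negPowerMean p l m (F x) (G y) ≤ H ((l : ℝ) • x + (m : ℝ) • y)) :
    negPowerMean (p - n) l m (∫⁻ x, F x) (∫⁻ x, G x) ≤ ∫⁻ x, H x := by
  induction n with
  | zero =>
    have : ∀ K : (Fin 0 → ℝ) → ℝ≥0∞, ∫⁻ x, K x = K 0 := fun K => by
      rw [volume_pi, Measure.pi_of_empty (x := 0), lintegral_dirac]
    rw [this, this, this, Nat.cast_zero, sub_zero]
    exact (h 0 0).trans (le_of_eq (congrArg H (Subsingleton.elim _ _)))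
  | succ n ih =>
    have hpn : (n : ℝ) + 1 < p := by simpa using hp
    let e := (MeasurableEquiv.piFinSuccAbove (fun _ : Fin (n + 1) => ℝ) 0).symm
    have he : MeasurePreserving e :=
      (volume_preserving_piFinSuccAbove (fun _ : Fin (n + 1) => ℝ) 0).symm _
    have hlin : ∀ a b : ℝ × (Fin n → ℝ), e ((l : ℝ) • a + (m : ℝ) • b) =
        (l : ℝ) • e a + (m : ℝ) • e b := by
      intro a b
      ext i
      refine Fin.cases ?_ (fun j => ?_) i <;> simp [e, MeasurableEquiv.piFinSuccAbove]
    have hint : ∀ {K : (Fin (n + 1) → ℝ) → ℝ≥0∞}, Measurable K →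
        ∫⁻ x, K x = ∫⁻ t : ℝ, ∫⁻ y : Fin n → ℝ, K (e (t, y)) := by
      intro K hK
      rw [← he.lintegral_comp hK, Measure.volume_eq_prod,
        lintegral_prod (fun z => K (e z)) (hK.comp e.measurable).aemeasurable]
    have hsec : ∀ {K : (Fin (n + 1) → ℝ) → ℝ≥0∞}, Measurable K → ∀ t : ℝ,
        Measurable fun y : Fin n → ℝ => K (e (t, y)) :=
      fun hK t => hK.comp (e.measurable.comp measurable_prodMk_left)
    have hout : ∀ {K : (Fin (n + 1) → ℝ) → ℝ≥0∞}, Measurable K →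
        Measurable fun t : ℝ => ∫⁻ y : Fin n → ℝ, K (e (t, y)) :=
      fun hK => (hK.comp e.measurable).lintegral_prod_right'
    rw [hint hF, hint hG, hint hH]
    have hexp : p - ((n + 1 : ℕ) : ℝ) = p - n - 1 := by push_cast; ring
    rw [hexp]
    refine negPowerMean_lintegral_le (by linarith) hl hm hlm (hout hF) (hout hG) (hout hH)
      fun s t => ?_
    refine ih (by linarith) (hsec hF s) (hsec hG t) (hsec hH _) fun x y => ?_
    refine (h _ _).trans (le_of_eq ?_)
    rw [← hlin]
    rfl

/-! ### Measures satisfying a Brunn–Minkowski inequality -/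

/-- A measure is `-1 / D`-concave if it satisfies the Brunn–Minkowski inequality
`μ (l A + m B) ≥ (l μ(A) ^ (-1 / D) + m μ(B) ^ (-1 / D)) ^ (-D)`. To avoid measurability questions,
`l A + m B` is replaced by any measurable set containing it. -/
def BrunnMinkowskiMeasure {E : Type*} [AddCommGroup E] [Module ℝ E] [MeasurableSpace E] (D : ℝ)
    (μ : Measure E) : Prop :=
  ∀ l m : ℝ≥0, l ≠ 0 → m ≠ 0 → l + m = 1 → ∀ A B C : Set E, MeasurableSet A → MeasurableSet B →
    MeasurableSet C → (∀ x ∈ A, ∀ y ∈ B, (l : ℝ) • x + (m : ℝ) • y ∈ C) →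
    negPowerMean D l m (μ A) (μ B) ≤ μ C

lemma BrunnMinkowskiMeasure.of_le {E : Type*} [AddCommGroup E] [Module ℝ E] [MeasurableSpace E]
    {D D' : ℝ} {μ : Measure E} (h : BrunnMinkowskiMeasure D μ) (hD' : 0 < D') (hD : D' ≤ D) :
    BrunnMinkowskiMeasure D' μ :=
  fun l m hl hm hlm A B C hA hB hC hABC =>
    (negPowerMean_le_of_le hD' hD hlm _ _).trans (h l m hl hm hlm A B C hA hB hC hABC)

lemma negPowerMean_ofReal {p : ℝ} (hp : 0 < p) {l m : ℝ≥0} (hl : l ≠ 0) (hlm : l + m = 1)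
    {a b : ℝ} (ha : 0 < a) (hb : 0 < b) :
    negPowerMean p l m (ENNReal.ofReal a) (ENNReal.ofReal b) =
      ENNReal.ofReal (weightedPowerMean (-p⁻¹) l a b) := by
  have hm : (m : ℝ) = 1 - l := by rw [eq_sub_iff_add_eq']; exact_mod_cast hlm
  have hl' : (0 : ℝ) < l := by exact_mod_cast pos_iff_ne_zero.2 hl
  have hs : -p⁻¹ ≠ 0 := neg_ne_zero.2 (inv_ne_zero hp.ne')
  have hs' : 1 / -p⁻¹ = -p := by field_simp
  have hA : 0 < a ^ (-p⁻¹) := Real.rpow_pos_of_pos ha _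
  have hB : 0 < b ^ (-p⁻¹) := Real.rpow_pos_of_pos hb _
  rw [weightedPowerMean, if_neg (by simp [ha.ne', hb.ne']), if_neg hs, hs', ← hm, negPowerMean,
    ENNReal.ofReal_rpow_of_pos ha, ENNReal.ofReal_rpow_of_pos hb, ← ENNReal.ofReal_coe_nnreal,
    ← ENNReal.ofReal_coe_nnreal (p := m), ← ENNReal.ofReal_mul (by positivity),
    ← ENNReal.ofReal_mul (by positivity), ← ENNReal.ofReal_add (by positivity) (by positivity),
    ENNReal.ofReal_rpow_of_pos (by positivity)]

/-- Borell's theorem: an `s`-concave density with `s = -1 / p` in dimension `n < p` gives a measure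
which is `-1 / (p - n)`-concave. -/
theorem SConcaveDistribution.brunnMinkowskiMeasure {n : ℕ} {p : ℝ} (hp : n < p)
    {μ : Measure (EuclideanSpace ℝ (Fin n))} (hμ : SConcaveDistribution (-p⁻¹) μ) :
    BrunnMinkowskiMeasure (p - n) μ := by
  obtain ⟨f, hf, ⟨hf0, hfc⟩, rfl⟩ := hμ
  intro l m hl hm hlm A B C hA hB hC hABC
  have hp0 : 0 < p := (Nat.cast_nonneg n).trans_lt hp
  have hm' : (m : ℝ) = 1 - l := by rw [eq_sub_iff_add_eq']; exact_mod_cast hlm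
  have hl0 : (0 : ℝ) < l := by exact_mod_cast pos_iff_ne_zero.2 hl
  have hm0 : (0 : ℝ) < m := by exact_mod_cast pos_iff_ne_zero.2 hm
  let e : (Fin n → ℝ) → EuclideanSpace ℝ (Fin n) := WithLp.toLp 2
  have he : MeasurePreserving e := PiLp.volume_preserving_toLp (Fin n)
  have hg : Measurable fun x => ENNReal.ofReal (f x) := ENNReal.measurable_ofReal.comp hf
  have hmu : ∀ S : Set (EuclideanSpace ℝ (Fin n)), MeasurableSet S →
      (volume.withDensity fun x => ENNReal.ofReal (f x)) S =
        ∫⁻ x, S.indicator (fun x => ENNReal.ofReal (f x)) (e x) := fun S hS => by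
    rw [withDensity_apply _ hS, ← lintegral_indicator hS,
      he.lintegral_comp (hg.indicator hS)]
  rw [hmu A hA, hmu B hB, hmu C hC]
  refine negPowerMean_lintegral_pi_le hl hm hlm n hp ((hg.indicator hA).comp he.measurable)
    ((hg.indicator hB).comp he.measurable) ((hg.indicator hC).comp he.measurable) fun x y => ?_
  have hexy : e ((l : ℝ) • x + (m : ℝ) • y) = (l : ℝ) • e x + (m : ℝ) • e y := rfl
  by_cases hx : e x ∈ A
  swap
  · simp [hx, negPowerMean_zero_left hp0 hl]
  by_cases hy : e y ∈ B
  swap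
  · simp [hy, negPowerMean_zero_right hp0 hm]
  rw [hexy, Set.indicator_of_mem hx, Set.indicator_of_mem hy,
    Set.indicator_of_mem (hABC _ hx _ hy)]
  rcases (hf0 (e x)).eq_or_lt with h0 | h0
  · simp [← h0, negPowerMean_zero_left hp0 hl]
  rcases (hf0 (e y)).eq_or_lt with h1 | h1
  · simp [← h1, negPowerMean_zero_right hp0 hm]
  rw [negPowerMean_ofReal hp0 hl hlm h0 h1, hm']
  exact ENNReal.ofReal_le_ofReal (hfc _ _ _ hl0 (by linarith))

/-- A log-concave function is `s`-concave for every negative `s`. -/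
lemma SConcaveFunction.of_zero {n : ℕ} {s : ℝ} (hs : s < 0) {f : EuclideanSpace ℝ (Fin n) → ℝ}
    (hf : SConcaveFunction 0 f) : SConcaveFunction s f := by
  refine ⟨hf.1, fun x y l hl hl1 => le_trans ?_ (hf.2 x y l hl hl1)⟩
  by_cases h : f x = 0 ∨ f y = 0
  · simp [weightedPowerMean, h]
  rw [weightedPowerMean, weightedPowerMean, if_neg h, if_neg h, if_neg hs.ne, if_pos rfl]
  have ha : 0 < f x := (hf.1 x).lt_of_ne fun e => h (Or.inl e.symm)
  have hb : 0 < f y := (hf.1 y).lt_of_ne fun e => h (Or.inr e.symm)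
  have key := Real.geom_mean_le_arith_mean2_weighted hl.le (by linarith : 0 ≤ 1 - l)
    (Real.rpow_nonneg ha.le s) (Real.rpow_nonneg hb.le s) (by ring)
  have h2 := Real.rpow_le_rpow_of_nonpos (z := 1 / s) (by positivity) key
    (one_div_nonpos.2 hs.le)
  refine h2.trans (le_of_eq ?_)
  rw [Real.mul_rpow (by positivity) (by positivity), ← Real.rpow_mul ha.le, ← Real.rpow_mul hb.le,
    ← Real.rpow_mul ha.le, ← Real.rpow_mul hb.le]
  have hs0 : s ≠ 0 := hs.ne
  congr 2 <;> field_simp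

lemma SConcaveDistribution.of_zero {n : ℕ} {s : ℝ} (hs : s < 0)
    {μ : Measure (EuclideanSpace ℝ (Fin n))} (hμ : SConcaveDistribution 0 μ) :
    SConcaveDistribution s μ := by
  obtain ⟨f, hf, hfc, rfl⟩ := hμ
  exact ⟨f, hf, hfc.of_zero hs, rfl⟩

/-! ### Tails of seminorms -/

/-- Borell's lemma: if a centred ball of a seminorm has mass at least `3 / 4`, then the mass outside
its dilates decays at the rate allowed by the concavity of the measure. -/
theorem BrunnMinkowskiMeasure.seminorm_tail_le {E : Type*} [AddCommGroup E] [Module ℝ E]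
    [MeasurableSpace E] {D : ℝ} {μ : Measure E} [IsProbabilityMeasure μ]
    (h : BrunnMinkowskiMeasure D μ) (hD : 0 < D) (N : Seminorm ℝ E) (hN : Measurable N) {R t : ℝ}
    (hR : 3 / 4 ≤ μ.real {x | N x ≤ R}) (ht : 1 < t) :
    μ.real {x | t * R < N x} ≤ (1 + t / (2 * D)) ^ (-D) := by
  have mK : MeasurableSet {x | N x ≤ R} := measurableSet_le hN measurable_const
  have mA : MeasurableSet {x | t * R < N x} := measurableSet_lt measurable_const hN
  have mC : MeasurableSet {x | R < N x} := measurableSet_lt measurable_const hN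
  set a := μ.real {x | t * R < N x} with ha
  set k := μ.real {x | N x ≤ R} with hk
  have hcompl : μ.real {x | R < N x} = 1 - k := by
    rw [hk, ← probReal_compl_eq_one_sub mK]
    congr 1
    ext x
    simp
  rcases (measureReal_nonneg : 0 ≤ a).eq_or_lt with ha0 | ha0
  · refine ha0.symm.le.trans ?_
    positivity
  have hk0 : 0 < k := by linarith
  -- the convex combination with weight `2 / (t + 1)` maps the exterior of the dilate and the ball
  -- into the exterior of the ball
  obtain ⟨l, hl⟩ : ∃ l : ℝ≥0, (l : ℝ) = 2 / (t + 1) := ⟨⟨2 / (t + 1), by positivity⟩, rfl⟩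
  have hl1 : (l : ℝ) < 1 := by rw [hl, div_lt_one (by linarith)]; linarith
  have hl0 : (0 : ℝ) < l := by rw [hl]; positivity
  obtain ⟨m, hm⟩ : ∃ m : ℝ≥0, (m : ℝ) = 1 - l := ⟨⟨1 - l, by linarith⟩, rfl⟩
  have hlm : l + m = 1 := by
    rw [← NNReal.coe_inj]; push_cast; linarith
  have hl' : l ≠ 0 := by rintro rfl; simp at hl0
  have hm' : m ≠ 0 := by rintro rfl; simp at hm; linarith
  have hm0 : (0 : ℝ) < m := by rw [hm]; linarith
  have key := h l m hl' hm' hlm _ _ {x | R < N x} mA mK mC fun x hx y hy => by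
    simp only [Set.mem_ofPred_eq] at hx hy ⊢
    have h1 : N ((l : ℝ) • x) ≤ N ((l : ℝ) • x + (m : ℝ) • y) + N ((m : ℝ) • y) := by
      have := map_sub_le_add N ((l : ℝ) • x + (m : ℝ) • y) ((m : ℝ) • y)
      rwa [add_sub_cancel_right] at this
    rw [map_smul_eq_mul, map_smul_eq_mul, Real.norm_of_nonneg hl0.le,
      Real.norm_of_nonneg hm0.le] at h1
    have h2 : l * (t * R) < l * N x := by gcongr
    have h3 : m * N y ≤ m * R := by gcongr
    have h4 : l * (t * R) - m * R = R := by rw [hm, hl]; field_simp; ring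
    linarith
  have e1 : μ {x | t * R < N x} = ENNReal.ofReal a := by rw [ha, ofReal_measureReal]
  have e2 : μ {x | N x ≤ R} = ENNReal.ofReal k := by rw [hk, ofReal_measureReal]
  have e3 : μ {x | R < N x} = ENNReal.ofReal (1 - k) := by rw [← hcompl, ofReal_measureReal]
  rw [e1, e2, e3, negPowerMean_ofReal hD hl' hlm ha0 hk0,
    ENNReal.ofReal_le_ofReal_iff (by rw [← hcompl]; exact measureReal_nonneg)] at key
  have hs : -D⁻¹ ≠ 0 := neg_ne_zero.2 (inv_ne_zero hD.ne')
  have hs' : 1 / -D⁻¹ = -D := by field_simp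
  rw [weightedPowerMean, if_neg (by simp [ha0.ne', hk0.ne']), if_neg hs, hs', ← hm] at key
  have hDi : 0 < D⁻¹ := inv_pos.2 hD
  have hA : 0 < a ^ (-D⁻¹) := Real.rpow_pos_of_pos ha0 _
  have hB : 0 < k ^ (-D⁻¹) := Real.rpow_pos_of_pos hk0 _
  have key2 : (4 : ℝ) ^ D⁻¹ ≤ l * a ^ (-D⁻¹) + m * k ^ (-D⁻¹) := by
    have h1 := Real.rpow_le_rpow_of_nonpos (z := -D⁻¹) (by positivity)
      (key.trans (show 1 - k ≤ (4 : ℝ)⁻¹ by linarith)) (by linarith)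
    rw [← Real.rpow_mul (by positivity), neg_mul_neg, mul_inv_cancel₀ hD.ne', Real.rpow_one,
      Real.inv_rpow (by norm_num), Real.rpow_neg (by norm_num), inv_inv] at h1
    exact h1
  have hkD : k ^ (-D⁻¹) ≤ (4 / 3 : ℝ) ^ D⁻¹ := by
    have h1 := Real.rpow_le_rpow_of_nonpos (z := -D⁻¹) (by norm_num) hR (by linarith)
    refine h1.trans (le_of_eq ?_)
    rw [Real.rpow_neg (by norm_num), ← Real.inv_rpow (by norm_num)]
    norm_num
  set u := (4 : ℝ) ^ D⁻¹ with hu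
  set v := (4 / 3 : ℝ) ^ D⁻¹ with hv
  have hu1 : 1 ≤ u := Real.one_le_rpow (by norm_num) hDi.le
  have hv1 : 1 ≤ v := Real.one_le_rpow (by norm_num) hDi.le
  have huv : v + D⁻¹ ≤ u := by
    have h1 : u = v * (3 : ℝ) ^ D⁻¹ := by
      rw [hu, hv, ← Real.mul_rpow (by norm_num) (by norm_num)]; norm_num
    have h2 : 1 + D⁻¹ ≤ (3 : ℝ) ^ D⁻¹ := by
      have h3 : (1 : ℝ) ≤ Real.log 3 := by
        rw [Real.le_log_iff_exp_le (by norm_num)]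
        exact Real.exp_one_lt_d9.le.trans (by norm_num)
      rw [Real.rpow_def_of_pos (by norm_num)]
      nlinarith [Real.add_one_le_exp (Real.log 3 * D⁻¹)]
    rw [h1]
    nlinarith
  have key3 : 1 + t / (2 * D) ≤ a ^ (-D⁻¹) := by
    have h1 : u ≤ l * a ^ (-D⁻¹) + m * v := key2.trans (by gcongr)
    rw [hm, hl] at h1
    have h2 : u * (t + 1) ≤ 2 * a ^ (-D⁻¹) + (t - 1) * v := by
      have h3 := mul_le_mul_of_nonneg_right h1 (by linarith : 0 ≤ t + 1)
      refine h3.trans (le_of_eq ?_)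
      field_simp
      ring
    have h4 : t / (2 * D) = t * D⁻¹ / 2 := by field_simp
    rw [h4]
    nlinarith
  have h5 := Real.rpow_le_rpow_of_nonpos (z := -D) (by positivity) key3 (by linarith)
  rwa [← Real.rpow_mul ha0.le, neg_mul_neg, inv_mul_cancel₀ hD.ne', Real.rpow_one] at h5

/-! ### Moments of isotropic measures -/

section Isotropic

variable {n : ℕ} {μ : Measure (EuclideanSpace ℝ (Fin n))}

lemma Isotropic.integrable_mul (h : Isotropic μ) (i j : Fin n) :
    Integrable (fun x : EuclideanSpace ℝ (Fin n) => x i * x j) μ := by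
  have key : ∀ i : Fin n, MemLp (fun x : EuclideanSpace ℝ (Fin n) => x i) 2 μ := fun i =>
    h.memLp.of_le (by fun_prop) (Eventually.of_forall fun x => PiLp.norm_apply_le x i)
  exact (key i).integrable_mul (key j)

lemma Isotropic.integrable_inner [IsProbabilityMeasure μ] (h : Isotropic μ)
    (e : EuclideanSpace ℝ (Fin n)) :
    Integrable (fun x => inner ℝ e x) μ :=
  (h.memLp.integrable (by norm_num)).const_inner e

lemma Isotropic.integral_inner [IsProbabilityMeasure μ] (h : Isotropic μ)
    (e : EuclideanSpace ℝ (Fin n)) :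
    ∫ x, inner ℝ e x ∂μ = 0 := by
  have hi : Integrable (fun x : EuclideanSpace ℝ (Fin n) => x) μ :=
    h.memLp.integrable (by norm_num)
  have hk : ∀ i : Fin n, Integrable (fun x : EuclideanSpace ℝ (Fin n) => x i) μ := fun i =>
    hi.mono (by fun_prop) (Eventually.of_forall fun x => PiLp.norm_apply_le x i)
  simp only [PiLp.inner_apply, RCLike.inner_apply, conj_trivial]
  rw [integral_finsetSum _ fun i _ => (hk i).mul_const _]
  simp [integral_mul_const, h.mean]

lemma inner_sq_eq_sum (e x : EuclideanSpace ℝ (Fin n)) :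
    inner ℝ e x ^ 2 = ∑ i, ∑ j, e i * e j * (x i * x j) := by
  simp only [PiLp.inner_apply, RCLike.inner_apply, conj_trivial]
  rw [sq, Finset.sum_mul_sum]
  exact Finset.sum_congr rfl fun i _ => Finset.sum_congr rfl fun j _ => by ring

lemma Isotropic.integrable_inner_sq (h : Isotropic μ) (e : EuclideanSpace ℝ (Fin n)) :
    Integrable (fun x => inner ℝ e x ^ 2) μ := by
  simp only [inner_sq_eq_sum]
  exact integrable_finsetSum _ fun i _ => integrable_finsetSum _ fun j _ =>
    (h.integrable_mul i j).const_mul _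

lemma Isotropic.integral_inner_sq (h : Isotropic μ) {e : EuclideanSpace ℝ (Fin n)}
    (he : ‖e‖ = 1) : ∫ x, inner ℝ e x ^ 2 ∂μ = 1 := by
  simp only [inner_sq_eq_sum]
  rw [integral_finsetSum _ fun i _ => integrable_finsetSum _ fun j _ =>
    (h.integrable_mul i j).const_mul _]
  have : ∀ i, ∫ x, ∑ j, e i * e j * (x i * x j) ∂μ = e i ^ 2 := fun i => by
    rw [integral_finsetSum _ fun j _ => (h.integrable_mul i j).const_mul _]
    simp [integral_const_mul, h.covariance, sq]
  rw [Finset.sum_congr rfl fun i _ => this i, ← EuclideanSpace.real_norm_sq_eq, he, one_pow]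

lemma Isotropic.integral_norm_sq (h : Isotropic μ) : ∫ x, ‖x‖ ^ 2 ∂μ = n := by
  simp only [EuclideanSpace.real_norm_sq_eq]
  simp only [sq]
  rw [integral_finsetSum _ fun i _ => h.integrable_mul i i]
  simp [h.covariance]

lemma Isotropic.integrable_norm_sq (h : Isotropic μ) : Integrable (fun x => ‖x‖ ^ 2) μ := by
  simp only [EuclideanSpace.real_norm_sq_eq]
  simp only [sq]
  exact integrable_finsetSum _ fun i _ => h.integrable_mul i i

lemma Isotropic.measureReal_inner_gt_le [IsProbabilityMeasure μ] (h : Isotropic μ)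
    {e : EuclideanSpace ℝ (Fin n)} (he : ‖e‖ = 1) {T : ℝ} (hT : 0 < T) :
    μ.real {x | T < |inner ℝ e x|} ≤ 1 / T ^ 2 := by
  have h1 := mul_meas_ge_le_integral_of_nonneg (μ := μ) (f := fun x => inner ℝ e x ^ 2)
    (Eventually.of_forall fun x => sq_nonneg _) (h.integrable_inner_sq e) (T ^ 2)
  rw [h.integral_inner_sq he] at h1
  rw [le_div_iff₀ (by positivity), mul_comm]
  refine le_trans (mul_le_mul_of_nonneg_left (measureReal_mono fun x hx => ?_) (by positivity)) h1
  have hx' : T < |inner ℝ e x| := hx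
  show T ^ 2 ≤ inner ℝ e x ^ 2
  rw [← sq_abs (inner ℝ e x)]
  gcongr

lemma Isotropic.measureReal_norm_le_ge [IsProbabilityMeasure μ] (h : Isotropic μ) (hn : n ≠ 0) :
    3 / 4 ≤ μ.real {x | ‖x‖ ≤ 2 * √n} := by
  have hn0 : (0 : ℝ) < n := by exact_mod_cast Nat.pos_of_ne_zero hn
  have hs : √(n : ℝ) ^ 2 = n := Real.sq_sqrt hn0.le
  have h1 := mul_meas_ge_le_integral_of_nonneg (μ := μ) (f := fun x => ‖x‖ ^ 2)
    (Eventually.of_forall fun x => sq_nonneg _) h.integrable_norm_sq (4 * n)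
  rw [h.integral_norm_sq] at h1
  have h2 : μ.real {x | 4 * (n : ℝ) ≤ ‖x‖ ^ 2} ≤ 1 / 4 := by nlinarith
  have h3 : μ.real {x | ‖x‖ ≤ 2 * √n}ᶜ ≤ 1 / 4 := by
    refine (measureReal_mono fun x hx => ?_).trans h2
    have hx' : 2 * √n < ‖x‖ := by simpa using hx
    show 4 * (n : ℝ) ≤ ‖x‖ ^ 2
    have : (2 * √(n : ℝ)) ^ 2 ≤ ‖x‖ ^ 2 := by gcongr
    rwa [mul_pow, hs, show (2 : ℝ) ^ 2 = 4 by norm_num] at this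
  rw [probReal_compl_eq_one_sub (measurableSet_le measurable_norm measurable_const)] at h3
  linarith

end Isotropic

/-! ### Masses of halfspaces -/

/-- A seminorm concentrated at scale `δ` has second moment of order `δ ^ 2`: summation of the tail
bound over dyadic shells. -/
lemma BrunnMinkowskiMeasure.lintegral_seminorm_sq_le {E : Type*} [AddCommGroup E] [Module ℝ E]
    [MeasurableSpace E] {μ : Measure E} [IsProbabilityMeasure μ]
    (h : BrunnMinkowskiMeasure 4 μ) (N : Seminorm ℝ E) (hN : Measurable N) {δ : ℝ} (hδ : 0 < δ)
    (hR : 3 / 4 ≤ μ.real {x | N x ≤ δ}) :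
    ∫⁻ x, ENNReal.ofReal (N x ^ 2) ∂μ ≤ ENNReal.ofReal (5466 * δ ^ 2) := by
  have hms : ∀ k : ℕ, MeasurableSet {x | 2 ^ (k + 1) * δ < N x} := fun k =>
    measurableSet_lt measurable_const hN
  have hpt : ∀ x, ENNReal.ofReal (N x ^ 2) ≤ ENNReal.ofReal (4 * δ ^ 2) +
      ∑' k : ℕ, {x | 2 ^ (k + 1) * δ < N x}.indicator
        (fun _ => ENNReal.ofReal ((2 ^ (k + 2) * δ) ^ 2)) x := by
    intro x
    rcases le_or_gt (N x) (2 * δ) with hx | hx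
    · refine le_add_right (ENNReal.ofReal_le_ofReal ?_)
      have := apply_nonneg N x
      nlinarith
    · refine le_add_left ?_
      obtain ⟨k, hk1, hk2⟩ := exists_mem_Ioc_zpow (x := N x / δ) (y := (2 : ℝ))
        (by have : 0 < N x := by linarith
            positivity) one_lt_two
      have h2 : (2 : ℝ) ^ (1 : ℤ) < 2 ^ (k + 1) := by
        refine lt_of_lt_of_le ?_ hk2
        rw [zpow_one, lt_div_iff₀ hδ]
        exact hx
      have h3 : 1 < k + 1 := (zpow_lt_zpow_iff_right₀ one_lt_two).1 h2
      obtain ⟨j, rfl⟩ : ∃ j : ℕ, k = (j + 1 : ℕ) := ⟨(k - 1).toNat, by omega⟩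
      rw [zpow_natCast, lt_div_iff₀ hδ] at hk1
      have hk2' : N x ≤ 2 ^ (j + 2) * δ := by
        rw [div_le_iff₀ hδ] at hk2
        exact_mod_cast hk2
      refine le_trans ?_ (ENNReal.le_tsum j)
      rw [Set.indicator_of_mem (by exact hk1)]
      refine ENNReal.ofReal_le_ofReal ?_
      have := apply_nonneg N x
      gcongr
  have htail : ∀ k : ℕ, ENNReal.ofReal ((2 ^ (k + 2) * δ) ^ 2) * μ {x | 2 ^ (k + 1) * δ < N x} ≤
      ENNReal.ofReal (4096 * δ ^ 2 * (1 / 4) ^ k) := by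
    intro k
    have h1 := h.seminorm_tail_le (by norm_num) N hN hR (t := 2 ^ (k + 1))
      (one_lt_pow₀ one_lt_two (by simp))
    rw [← ofReal_measureReal, ← ENNReal.ofReal_mul (by positivity)]
    refine ENNReal.ofReal_le_ofReal ((mul_le_mul_of_nonneg_left h1 (by positivity)).trans ?_)
    have h2 : (1 + 2 ^ (k + 1) / (2 * (4 : ℝ))) ^ (-(4 : ℝ)) ≤ 256 / 16 ^ k := by
      rw [Real.rpow_neg (by positivity), show (4 : ℝ) = (4 : ℕ) by norm_num, Real.rpow_natCast]
      rw [inv_le_comm₀ (by positivity) (by positivity), inv_div]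
      have h3 : (2 : ℝ) ^ k / 4 ≤ 1 + 2 ^ (k + 1) / (2 * (4 : ℕ)) := by
        push_cast
        rw [pow_succ]
        linarith
      calc (16 : ℝ) ^ k / 256 = (2 ^ k / 4) ^ 4 := by
            rw [div_pow, ← pow_mul, mul_comm k 4, pow_mul]; norm_num
        _ ≤ _ := by gcongr
    refine (mul_le_mul_of_nonneg_left h2 (by positivity)).trans (le_of_eq ?_)
    have h4 : ((2 : ℝ) ^ (k + 2) * δ) ^ 2 = 16 * 4 ^ k * δ ^ 2 := by
      have : (4 : ℝ) ^ k = (2 ^ k) ^ 2 := by rw [← pow_mul, mul_comm, pow_mul]; norm_num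
      rw [this]
      ring
    have h5 : (16 : ℝ) ^ k = 4 ^ k * 4 ^ k := by rw [← mul_pow]; norm_num
    rw [h4, h5, one_div_pow]
    field_simp
    norm_num
  calc ∫⁻ x, ENNReal.ofReal (N x ^ 2) ∂μ
      ≤ ∫⁻ x, (ENNReal.ofReal (4 * δ ^ 2) + ∑' k : ℕ, {x | 2 ^ (k + 1) * δ < N x}.indicator
        (fun _ => ENNReal.ofReal ((2 ^ (k + 2) * δ) ^ 2)) x) ∂μ := lintegral_mono hpt
    _ = ENNReal.ofReal (4 * δ ^ 2) + ∑' k : ℕ, ENNReal.ofReal ((2 ^ (k + 2) * δ) ^ 2) *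
        μ {x | 2 ^ (k + 1) * δ < N x} := by
        rw [lintegral_add_left measurable_const, lintegral_const, measure_univ, mul_one,
          lintegral_tsum fun k => (measurable_const.indicator (hms k)).aemeasurable]
        congr 2
        ext k
        rw [lintegral_indicator_const (hms k)]
    _ ≤ ENNReal.ofReal (4 * δ ^ 2) + ∑' k : ℕ, ENNReal.ofReal (4096 * δ ^ 2 * (1 / 4) ^ k) := by
        gcongr with k
        exact htail k
    _ ≤ ENNReal.ofReal (5466 * δ ^ 2) := by
        have hsum : HasSum (fun k : ℕ => 4096 * δ ^ 2 * (1 / 4 : ℝ) ^ k)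
            (4096 * δ ^ 2 * (1 - 1 / 4)⁻¹) :=
          (hasSum_geometric_of_lt_one (by norm_num) (by norm_num)).mul_left _
        rw [← ENNReal.ofReal_tsum_of_nonneg (fun k => by positivity) hsum.summable, hsum.tsum_eq,
          ← ENNReal.ofReal_add (by positivity) (by positivity)]
        refine ENNReal.ofReal_le_ofReal ?_
        norm_num
        nlinarith [sq_nonneg δ]

section

variable {n : ℕ} {μ : Measure (EuclideanSpace ℝ (Fin n))} [IsProbabilityMeasure μ]

lemma measurable_inner_left (e : EuclideanSpace ℝ (Fin n)) :
    Measurable fun x : EuclideanSpace ℝ (Fin n) => inner ℝ e x := by fun_prop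

/-- A unit variance prevents `⟪e, x⟫` from concentrating at scale `1 / 80`. -/
lemma Isotropic.measureReal_abs_inner_gt_ge (h : Isotropic μ) (hμ : BrunnMinkowskiMeasure 4 μ)
    {e : EuclideanSpace ℝ (Fin n)} (he : ‖e‖ = 1) :
    1 / 4 ≤ μ.real {x | 1 / 80 < |inner ℝ e x|} := by
  by_contra! hlt
  let N : Seminorm ℝ (EuclideanSpace ℝ (Fin n)) :=
    (normSeminorm ℝ ℝ).comp (innerSL ℝ e).toLinearMap
  have hNe : ∀ x, N x = |inner ℝ e x| := fun x => rfl
  have hN : Measurable N := by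
    have : (N : EuclideanSpace ℝ (Fin n) → ℝ) = fun x => |inner ℝ e x| := rfl
    rw [this]
    exact (measurable_inner_left e).abs
  have hc : μ.real {x | N x ≤ 1 / 80} = 1 - μ.real {x | 1 / 80 < |inner ℝ e x|} := by
    rw [← probReal_compl_eq_one_sub
      (measurableSet_lt measurable_const (measurable_inner_left e).abs)]
    congr 1
    ext x
    simp [hNe]
  have h1 := hμ.lintegral_seminorm_sq_le N hN (δ := 1 / 80) (by norm_num) (by rw [hc]; linarith)
  have h2 : ∫⁻ x, ENNReal.ofReal (N x ^ 2) ∂μ = 1 := by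
    simp only [hNe, sq_abs]
    rw [← ofReal_integral_eq_lintegral_ofReal (h.integrable_inner_sq e)
      (Eventually.of_forall fun x => sq_nonneg _), h.integral_inner_sq he, ENNReal.ofReal_one]
  -- `5466 / 80 ^ 2 < 1` contradicts the unit variance
  rw [h2, ENNReal.one_le_ofReal] at h1
  norm_num at h1

/-- Every halfspace at distance `1 / 2560` from the origin has mass bounded below: since the
functional `⟪e, x⟫` has mean zero, its positive part has the same mean as its negative part, and
its variance controls the contribution of large values. -/
lemma Isotropic.measureReal_inner_gt_ge (h : Isotropic μ) (hμ : BrunnMinkowskiMeasure 4 μ)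
    {e : EuclideanSpace ℝ (Fin n)} (he : ‖e‖ = 1) :
    1 / 10 ^ 6 ≤ μ.real {x | 1 / 2560 < inner ℝ e x} := by
  have m1 : MeasurableSet {x : EuclideanSpace ℝ (Fin n) | 1 / 80 < |inner ℝ e x|} :=
    measurableSet_lt measurable_const (measurable_inner_left e).abs
  have m2 : MeasurableSet {x : EuclideanSpace ℝ (Fin n) | 1 / 2560 < inner ℝ e x} :=
    measurableSet_lt measurable_const (measurable_inner_left e)
  have i1 : Integrable ({x : EuclideanSpace ℝ (Fin n) | 1 / 80 < |inner ℝ e x|}.indicator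
      fun _ => (1 / 160 : ℝ)) μ := (integrable_const _).indicator m1
  have i2 : Integrable ({x : EuclideanSpace ℝ (Fin n) | 1 / 2560 < inner ℝ e x}.indicator
      fun _ => (640 : ℝ)) μ := (integrable_const _).indicator m2
  have hpt : ∀ x, {x : EuclideanSpace ℝ (Fin n) | 1 / 80 < |inner ℝ e x|}.indicator
      (fun _ => (1 / 160 : ℝ)) x + inner ℝ e x / 2 ≤
      1 / 2560 + ({x : EuclideanSpace ℝ (Fin n) | 1 / 2560 < inner ℝ e x}.indicator
      (fun _ => (640 : ℝ)) x + inner ℝ e x ^ 2 / 2560) := by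
    intro x
    -- points with `1 / 2560 < X` are handled by `X ≤ 640 + X ^ 2 / 2560`
    set X : ℝ := inner ℝ e x with hX
    simp only [Set.indicator, Set.mem_ofPred_eq, ← hX]
    split_ifs with h1 h2 h2
    · rw [abs_of_pos (by linarith)] at h1
      nlinarith [sq_nonneg (X - 1280)]
    · rcases lt_abs.1 h1 with h3 | h3 <;> nlinarith [sq_nonneg X]
    · nlinarith [sq_nonneg (X - 1280)]
    · nlinarith [sq_nonneg X]
  have i3 : Integrable (fun x => {x : EuclideanSpace ℝ (Fin n) | 1 / 2560 < inner ℝ e x}.indicator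
      (fun _ => (640 : ℝ)) x + inner ℝ e x ^ 2 / 2560) μ :=
    i2.add ((h.integrable_inner_sq e).div_const 2560)
  have hint := integral_mono (i1.add ((h.integrable_inner e).div_const 2))
    ((integrable_const (1 / 2560 : ℝ)).add i3) hpt
  simp only [Pi.add_apply] at hint
  rw [integral_add i1 ((h.integrable_inner e).div_const 2),
    integral_add (integrable_const _) i3,
    integral_add i2 ((h.integrable_inner_sq e).div_const 2560),
    integral_indicator_const _ m1, integral_indicator_const _ m2] at hint
  simp only [integral_div] at hint
  rw [h.integral_inner, h.integral_inner_sq he] at hint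
  have := h.measureReal_abs_inner_gt_ge hμ he
  simp only [smul_eq_mul, integral_const, probReal_univ] at hint
  linarith

end

/-! ### Density bounds for projections -/

/-- Pigeonhole principle for measures: a set cut into finitely many pieces of small mass is
small. -/
lemma measureReal_le_card_mul {E ι : Type*} [MeasurableSpace E] {μ : Measure E} [IsFiniteMeasure μ]
    {S : Set E} (g : E → ι) (I : Finset ι) {κ : ℝ} (hκ : 0 ≤ κ) (hg : ∀ x ∈ S, g x ∈ I)
    (h : ∀ x ∈ S, μ.real {y | y ∈ S ∧ g y = g x} ≤ κ) : μ.real S ≤ I.card * κ := by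
  have hS : S ⊆ ⋃ i ∈ I, {y | y ∈ S ∧ g y = i} := fun x hx => by
    simpa using ⟨hx, hg x hx⟩
  refine (measureReal_mono hS (measure_ne_top _ _)).trans
    ((measureReal_biUnion_finset_le _ _).trans ?_)
  rw [← nsmul_eq_mul]
  refine Finset.sum_le_card_nsmul _ _ _ fun i _ => ?_
  rcases Set.eq_empty_or_nonempty {y | y ∈ S ∧ g y = i} with h0 | ⟨x, hx, rfl⟩
  · rw [h0, measureReal_empty]; exact hκ
  · exact h x hx

lemma abs_sub_le_of_floor_div_eq {a b c : ℝ} (hc : 0 < c) (h : ⌊a / c⌋ = ⌊b / c⌋) :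
    |a - b| ≤ c := by
  have h1 := Int.abs_sub_lt_one_of_floor_eq_floor h
  rw [← sub_div, abs_div, abs_of_pos hc, div_lt_one hc] at h1
  exact h1.le

/-- For weights `m ≤ q`, the mean of order `-1 / 4` of `a` and `a q ^ 4` is comparable to `a`. -/
lemma div_sixteen_le_negPowerMean {l m : ℝ≥0} (hl : l ≠ 0) (hlm : l + m = 1) {a q : ℝ} (ha : 0 < a)
    (hq : 0 < q) (hmq : (m : ℝ) ≤ q) :
    ENNReal.ofReal (a / 16) ≤
      negPowerMean 4 l m (ENNReal.ofReal a) (ENNReal.ofReal (a * q ^ 4)) := by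
  have hm' : (m : ℝ) = 1 - l := by rw [eq_sub_iff_add_eq']; exact_mod_cast hlm
  have hl0 : (0 : ℝ) ≤ l := l.2
  have hm0 : (0 : ℝ) ≤ m := m.2
  rw [ENNReal.ofReal_mul ha.le]
  nth_rw 1 [← mul_one (ENNReal.ofReal a)]
  rw [negPowerMean_mul (by norm_num) _ _ (by simpa using ha) (by simp), ← ENNReal.ofReal_one,
    negPowerMean_ofReal (by norm_num) hl hlm one_pos (by positivity), div_eq_mul_inv,
    ENNReal.ofReal_mul ha.le]
  gcongr
  rw [weightedPowerMean, if_neg (by simp [hq.ne']), if_neg (by norm_num), ← hm', Real.one_rpow,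
    show (1 : ℝ) / -4⁻¹ = -4 by norm_num]
  have h1 : (q ^ 4 : ℝ) ^ (-4⁻¹ : ℝ) = q⁻¹ := by
    rw [← Real.rpow_natCast, ← Real.rpow_mul hq.le, ← Real.rpow_neg_one q]
    congr 1
    norm_num
  rw [h1]
  have h2 : (l : ℝ) * 1 + m * q⁻¹ ≤ 2 := by
    have : (m : ℝ) * q⁻¹ ≤ 1 := by rw [← div_eq_mul_inv, div_le_one hq]; exact hmq
    linarith
  have h3 : 0 < (l : ℝ) * 1 + m * q⁻¹ := by
    have : (0 : ℝ) < l := by exact_mod_cast pos_iff_ne_zero.2 hl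
    positivity
  calc (16 : ℝ)⁻¹ = 2 ^ (-4 : ℝ) := by
        rw [Real.rpow_neg (by norm_num), show (4 : ℝ) = (4 : ℕ) by norm_num, Real.rpow_natCast]
        norm_num
    _ ≤ _ := Real.rpow_le_rpow_of_nonpos h3 h2 (by norm_num)

section

variable {n : ℕ} {μ : Measure (EuclideanSpace ℝ (Fin n))} [IsProbabilityMeasure μ]

lemma measurableSet_abs_inner_sub_le (e : EuclideanSpace ℝ (Fin n)) (y b : ℝ) :
    MeasurableSet {x : EuclideanSpace ℝ (Fin n) | |inner ℝ e x - y| ≤ b} :=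
  measurableSet_le ((measurable_inner_left e).sub_const y).abs measurable_const

/-- Some slab of half-width `b` centred at distance at least `1 / 2560` from the origin has mass of
order `b`. -/
lemma Isotropic.exists_slab_measureReal_ge (h : Isotropic μ) (hμ : BrunnMinkowskiMeasure 4 μ)
    {e : EuclideanSpace ℝ (Fin n)} (he : ‖e‖ = 1) {b : ℝ} (hb : 0 < b) (hb1 : b ≤ 1) :
    ∃ y : ℝ, 1 / 2560 < y ∧ b / 10 ^ 10 ≤ μ.real {x | |inner ℝ e x - y| ≤ b} := by
  by_contra! hlt
  set S : Set (EuclideanSpace ℝ (Fin n)) := {x | 1 / 2560 < inner ℝ e x ∧ inner ℝ e x ≤ 2000}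
    with hS
  have h1 : 1 / 10 ^ 6 ≤ μ.real S + 1 / 2000 ^ 2 := by
    refine (h.measureReal_inner_gt_ge hμ he).trans ?_
    refine le_trans ?_ (add_le_add_right (h.measureReal_inner_gt_le he (T := 2000) (by norm_num)) _)
    refine (measureReal_mono fun x hx => ?_).trans (measureReal_union_le _ _)
    have hx' : 1 / 2560 < inner ℝ e x := hx
    rcases le_or_gt (inner ℝ e x) 2000 with h2 | h2
    · exact Or.inl ⟨hx', h2⟩
    · exact Or.inr (h2.trans_le (le_abs_self _))
  have h2 : μ.real S ≤ (Finset.range (⌊2000 / b⌋₊ + 1)).card * (b / 10 ^ 10) := by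
    refine measureReal_le_card_mul (fun x => ⌊inner ℝ e x / b⌋₊) _ (by positivity) ?_ ?_
    · intro x hx
      have := hx.2
      simp only [Finset.mem_range]
      refine Nat.lt_succ_of_le (Nat.floor_le_floor ?_)
      gcongr
    · intro x hx
      refine le_trans (measureReal_mono ?_) (hlt (inner ℝ e x) hx.1).le
      rintro y ⟨hy, hyx⟩
      refine abs_sub_le_of_floor_div_eq hb ?_
      have hx0 : 0 ≤ inner ℝ e x / b := div_nonneg (by linarith [hx.1]) hb.le
      have hy0 : 0 ≤ inner ℝ e y / b := div_nonneg (by linarith [hy.1]) hb.le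
      rw [← Int.natCast_floor_eq_floor hx0, ← Int.natCast_floor_eq_floor hy0]
      exact_mod_cast hyx
  have h3 : ((Finset.range (⌊2000 / b⌋₊ + 1)).card : ℝ) ≤ 2001 / b := by
    rw [Finset.card_range, Nat.cast_add, Nat.cast_one]
    have h4 : (⌊2000 / b⌋₊ : ℝ) ≤ 2000 / b := Nat.floor_le (by positivity)
    have h5 : 1 ≤ 1 / b := by rw [le_div_iff₀ hb]; linarith
    calc (⌊2000 / b⌋₊ : ℝ) + 1 ≤ 2000 / b + 1 / b := add_le_add h4 h5
      _ = _ := by rw [← add_div]; norm_num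
  have h6 : μ.real S ≤ 2001 / b * (b / 10 ^ 10) := h2.trans (by gcongr)
  have h7 : 2001 / b * (b / 10 ^ 10) = 2001 / 10 ^ 10 := by field_simp
  rw [h7] at h6
  norm_num at h1 h6
  linarith

/-- The one-dimensional marginals have density bounded by a universal constant: by concavity, a large
density at the origin forces a large density on a neighbourhood which carries too much mass. -/
lemma exists_slab_measureReal_le : ∃ C : ℝ, 0 < C ∧ ∀ (n : ℕ)
    (μ : Measure (EuclideanSpace ℝ (Fin n))), IsProbabilityMeasure μ → Isotropic μ →
    BrunnMinkowskiMeasure 4 μ → ∀ e : EuclideanSpace ℝ (Fin n), ‖e‖ = 1 → ∀ b : ℝ, 0 < b →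
    μ.real {x | |inner ℝ e x| ≤ b} ≤ C * b := by
  set M : ℝ := 48 * 2560 with hM
  -- the density `K` at the origin satisfies `K ^ 3 ≤ M ^ 4 * 10 ^ 10`
  refine ⟨M ^ 4 * 10 ^ 10, by positivity, fun n μ _ h hμ e he b hb => ?_⟩
  set a := μ.real {x | |inner ℝ e x| ≤ b} with ha
  rcases le_or_gt a (b / 10 ^ 10) with hab | hab
  · refine hab.trans ?_
    rw [hM, div_eq_mul_inv, mul_comm]
    gcongr
    norm_num
  rcases lt_or_ge 1 b with hb1 | hb1
  · refine (measureReal_le_one : a ≤ 1).trans ?_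
    nlinarith [show (1 : ℝ) ≤ M ^ 4 * 10 ^ 10 by rw [hM]; norm_num]
  have ha0 : 0 < a := lt_trans (by positivity) hab
  obtain ⟨y, hy, hyb⟩ := h.exists_slab_measureReal_ge hμ he hb hb1
  have hy0 : 0 < y := lt_trans (by norm_num) hy
  -- `q` is chosen so that the slab centred at `y` has mass at least `a q ^ 4`
  set q : ℝ := (b / 10 ^ 10 / a) ^ (1 / 4 : ℝ) with hq
  have hq0 : 0 < q := by positivity
  have hq4 : a * q ^ 4 = b / 10 ^ 10 := by
    rw [hq, ← Real.rpow_natCast, ← Real.rpow_mul (by positivity)]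
    norm_num
    field_simp
  have hq1 : q ≤ 1 := by
    refine Real.rpow_le_one (by positivity) ?_ (by norm_num)
    rw [div_le_one ha0]
    exact hab.le
  -- every slab centred at `t` in `[0, q / 2560)` has mass at least `a / 16`
  have hslab : ∀ t : ℝ, 0 ≤ t → t < q / 2560 →
      a / 16 ≤ μ.real {x | |inner ℝ e x - t| ≤ b} := by
    intro t ht htq
    rcases ht.eq_or_lt with rfl | ht0
    · simp only [sub_zero, ← ha]
      linarith
    have hty : t < q * y := by nlinarith
    obtain ⟨m, hm⟩ : ∃ m : ℝ≥0, (m : ℝ) = t / y := ⟨⟨t / y, by positivity⟩, rfl⟩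
    have hmq : (m : ℝ) < q := by rw [hm, div_lt_iff₀ hy0]; exact hty
    have hm0 : (0 : ℝ) < m := by rw [hm]; positivity
    obtain ⟨l, hl⟩ : ∃ l : ℝ≥0, (l : ℝ) = 1 - m := ⟨⟨1 - m, by linarith⟩, rfl⟩
    have hl0 : (0 : ℝ) < l := by rw [hl]; linarith
    have hl' : l ≠ 0 := by rintro rfl; simp at hl0
    have hm' : m ≠ 0 := by rintro rfl; simp at hm0
    have hlm : l + m = 1 := by
      rw [← NNReal.coe_inj]; push_cast; linarith
    have key := hμ l m hl' hm' hlm {x | |inner ℝ e x| ≤ b} {x | |inner ℝ e x - y| ≤ b}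
      {x | |inner ℝ e x - t| ≤ b} (by simpa using measurableSet_abs_inner_sub_le e 0 b)
      (measurableSet_abs_inner_sub_le e y b)
      (measurableSet_abs_inner_sub_le e t b) fun x hx z hz => by
        simp only [Set.mem_ofPred_eq] at hx hz ⊢
        rw [inner_add_right, real_inner_smul_right, real_inner_smul_right]
        have hmt : m * y = t := by rw [hm]; field_simp
        calc |l * inner ℝ e x + m * inner ℝ e z - t|
            = |l * inner ℝ e x + m * (inner ℝ e z - y)| := by rw [← hmt]; ring_nf
          _ ≤ |(l : ℝ) * inner ℝ e x| + |(m : ℝ) * (inner ℝ e z - y)| := abs_add_le _ _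
          _ = l * |inner ℝ e x| + m * |inner ℝ e z - y| := by
              rw [abs_mul, abs_mul, abs_of_pos hl0, abs_of_pos hm0]
          _ ≤ l * b + m * b := by gcongr
          _ = b := by rw [hl]; ring
    have h1 : negPowerMean 4 l m (ENNReal.ofReal a) (ENNReal.ofReal (a * q ^ 4)) ≤
        μ {x | |inner ℝ e x - t| ≤ b} := by
      refine le_trans (negPowerMean_mono (by norm_num) ?_ ?_) key
      · rw [ha, ofReal_measureReal]
      · rw [hq4, ← ofReal_measureReal]
        exact ENNReal.ofReal_le_ofReal hyb
    have h2 := (div_sixteen_le_negPowerMean hl' hlm ha0 hq0 hmq.le).trans h1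
    rw [← ofReal_measureReal, ENNReal.ofReal_le_ofReal_iff measureReal_nonneg] at h2
    exact h2
  -- the slabs centred at `3 b j` are disjoint, and `N` of them are centred in that interval
  set N : ℕ := ⌈q / 2560 / (3 * b)⌉₊ with hN
  have hsum : ∑ j ∈ Finset.range N, μ.real {x | |inner ℝ e x - 3 * b * j| ≤ b} ≤ 1 := by
    rw [← measureReal_biUnion_finset]
    · exact measureReal_le_one
    · intro i _ j _ hij
      refine Set.disjoint_left.2 fun x hx hx' => ?_
      simp only [Set.mem_ofPred_eq, abs_le] at hx hx'
      rcases lt_or_gt_of_ne hij with h1 | h1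
      · have : (i : ℝ) + 1 ≤ j := by exact_mod_cast h1
        nlinarith
      · have : (j : ℝ) + 1 ≤ i := by exact_mod_cast h1
        nlinarith
    · exact fun j _ => measurableSet_abs_inner_sub_le e _ b
  have hN1 : N * (a / 16) ≤ 1 := by
    have h1 := Finset.card_nsmul_le_sum (Finset.range N)
      (fun j : ℕ => μ.real {x | |inner ℝ e x - 3 * b * j| ≤ b}) (a / 16) fun j hj => by
        refine hslab _ (by positivity) ?_
        have := Nat.lt_ceil.1 (Finset.mem_range.1 hj)
        rwa [lt_div_iff₀ (by positivity), mul_comm] at this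
    rw [Finset.card_range, nsmul_eq_mul] at h1
    exact h1.trans hsum
  have hN2 : q / 2560 / (3 * b) ≤ N := Nat.le_ceil _
  have hqa : a * q ≤ M * b := by
    have h1 : q / 2560 / (3 * b) * (a / 16) ≤ 1 :=
      (mul_le_mul_of_nonneg_right hN2 (by positivity)).trans hN1
    rw [div_div, div_mul_div_comm, div_le_one (by positivity)] at h1
    rw [hM]
    linarith
  -- with `K = a / b`, the relations `K q ^ 4 = 10 ^ (-10)` and `K q ≤ M` bound `K ^ 3`
  set K := a / b with hK
  have hK0 : 0 < K := by positivity
  have hKa : a = K * b := by rw [hK]; field_simp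
  have k1 : K * q ≤ M := by
    rw [hKa] at hqa
    exact le_of_mul_le_mul_right (by linarith) hb
  have k2 : K * q ^ 4 = 1 / 10 ^ 10 := by
    rw [hKa] at hq4
    have : b * (K * q ^ 4) = b * (1 / 10 ^ 10) := by linarith
    exact mul_left_cancel₀ hb.ne' this
  have k3 : K ^ 3 ≤ M ^ 4 * 10 ^ 10 := by
    have h1 : (K * q) ^ 4 ≤ M ^ 4 := by gcongr
    have h2 : (K * q) ^ 4 = K ^ 3 * (1 / 10 ^ 10) := by rw [← k2]; ring
    rw [h2] at h1
    linarith
  rw [hKa]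
  gcongr
  rcases le_or_gt K 1 with h1 | h1
  · exact h1.trans (by rw [hM]; norm_num)
  · exact (le_self_pow₀ h1.le (by norm_num)).trans k3

end

section

variable {n : ℕ}

lemma measurableSet_cell (e₁ e₂ : EuclideanSpace ℝ (Fin n)) (a b z₁ z₂ : ℝ) :
    MeasurableSet {x : EuclideanSpace ℝ (Fin n) |
      |inner ℝ e₁ x - z₁| ≤ a ∧ |inner ℝ e₂ x - z₂| ≤ b} :=
  (measurableSet_abs_inner_sub_le e₁ z₁ a).inter (measurableSet_abs_inner_sub_le e₂ z₂ b)

/-- The centres of the `a × b` cells (in the coordinates `⟪e₁, x⟫` and `⟪e₂, x⟫`) whose mass is at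
least `κ` form a convex set. -/
lemma BrunnMinkowskiMeasure.convex_heavy_cells {D : ℝ} (hD : 0 < D)
    {μ : Measure (EuclideanSpace ℝ (Fin n))} [IsProbabilityMeasure μ]
    (hμ : BrunnMinkowskiMeasure D μ) (e₁ e₂ : EuclideanSpace ℝ (Fin n)) (a b κ : ℝ) :
    Convex ℝ {z : ℝ × ℝ | κ ≤ μ.real {x | |inner ℝ e₁ x - z.1| ≤ a ∧ |inner ℝ e₂ x - z.2| ≤ b}} := by
  rw [convex_iff_forall_pos]
  intro z hz z' hz' l m hl hm hlm
  lift l to ℝ≥0 using hl.le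
  lift m to ℝ≥0 using hm.le
  have hlm' : l + m = 1 := by exact_mod_cast hlm
  have hl' : l ≠ 0 := by rintro rfl; simp at hl
  have hm' : m ≠ 0 := by rintro rfl; simp at hm
  have hcomb : ∀ (e : EuclideanSpace ℝ (Fin n)) {x y : EuclideanSpace ℝ (Fin n)} {s t c : ℝ},
      |inner ℝ e x - s| ≤ c → |inner ℝ e y - t| ≤ c →
      |inner ℝ e ((l : ℝ) • x + (m : ℝ) • y) - (l * s + m * t)| ≤ c := by
    intro e x y s t c hx hy
    rw [inner_add_right, real_inner_smul_right, real_inner_smul_right]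
    calc |(l : ℝ) * inner ℝ e x + m * inner ℝ e y - (l * s + m * t)|
        = |(l : ℝ) * (inner ℝ e x - s) + m * (inner ℝ e y - t)| := by ring_nf
      _ ≤ |(l : ℝ) * (inner ℝ e x - s)| + |(m : ℝ) * (inner ℝ e y - t)| := abs_add_le _ _
      _ = l * |inner ℝ e x - s| + m * |inner ℝ e y - t| := by
          rw [abs_mul, abs_mul, abs_of_pos hl, abs_of_pos hm]
      _ ≤ l * c + m * c := by gcongr
      _ = c := by rw [← add_mul, hlm, one_mul]
  have key := hμ l m hl' hm' hlm' _ _ _ (measurableSet_cell e₁ e₂ a b z.1 z.2)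
    (measurableSet_cell e₁ e₂ a b z'.1 z'.2)
    (measurableSet_cell e₁ e₂ a b (l * z.1 + m * z'.1) (l * z.2 + m * z'.2))
    fun x hx y hy => ⟨hcomb e₁ hx.1 hy.1, hcomb e₂ hx.2 hy.2⟩
  have key2 := (le_negPowerMean hD hlm' (ENNReal.ofReal_le_of_le_toReal hz)
    (ENNReal.ofReal_le_of_le_toReal hz')).trans key
  exact (ENNReal.ofReal_le_iff_le_toReal (measure_ne_top _ _)).1 key2

lemma card_Icc_floor_le {T c : ℝ} (hT : 0 ≤ T) (hc : 0 < c) (hc1 : c ≤ 1) :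
    ((Finset.Icc ⌊-T / c⌋ ⌊T / c⌋).card : ℝ) ≤ (2 * T + 2) / c := by
  have h0 : -T / c ≤ T / c := by gcongr; linarith
  rw [Int.card_Icc]
  have h1 : ((⌊T / c⌋ + 1 - ⌊-T / c⌋).toNat : ℤ) = ⌊T / c⌋ + 1 - ⌊-T / c⌋ :=
    Int.toNat_of_nonneg (by have := Int.floor_le_floor h0; omega)
  have h2 : ((⌊T / c⌋ + 1 - ⌊-T / c⌋).toNat : ℝ) = ⌊T / c⌋ + 1 - ⌊-T / c⌋ := by
    exact_mod_cast congrArg (Int.cast : ℤ → ℝ) h1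
  rw [h2]
  have h3 := Int.floor_le (T / c)
  have h4 := Int.sub_one_lt_floor (-T / c)
  have h5 : 1 ≤ 1 / c := by rw [le_div_iff₀ hc]; linarith
  have h6 : (2 * T + 2) / c = T / c - -T / c + 2 * (1 / c) := by ring
  rw [h6]
  linarith

lemma floor_div_mem_Icc {T c x : ℝ} (hc : 0 < c) (hx : |x| ≤ T) :
    ⌊x / c⌋ ∈ Finset.Icc ⌊-T / c⌋ ⌊T / c⌋ := by
  rw [abs_le] at hx
  rw [Finset.mem_Icc]
  constructor <;> refine Int.floor_le_floor ?_ <;> gcongr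
  · exact hx.1
  · exact hx.2

/-- A thin double wedge around the hyperplane `⟪e₁, x⟫ = 0` has mass at least proportional to its
opening. The heavy cells form a convex set; if a cell in the wedge near the origin were not heavy,
a halfspace through it would contain only light cells, and its mass would be too small. -/
lemma exists_wedge_measureReal_ge : ∃ c : ℝ, 0 < c ∧ c ≤ 1 / 10 ^ 6 ∧ ∀ (n : ℕ)
    (μ : Measure (EuclideanSpace ℝ (Fin n))), IsProbabilityMeasure μ → Isotropic μ →
    BrunnMinkowskiMeasure 4 μ → ∀ e₁ e₂ : EuclideanSpace ℝ (Fin n), ‖e₁‖ = 1 → ‖e₂‖ = 1 →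
    inner ℝ e₁ e₂ = 0 → ∀ σ : ℝ, 0 < σ → σ ≤ 1 →
    c * σ ≤ μ.real {x | inner ℝ e₁ x * inner ℝ e₂ x < 0 ∧ |inner ℝ e₁ x| < σ * |inner ℝ e₂ x|} := by
  -- `7 ρ = 1 / 2560`, so that the cell centre `(2 σ ρ, -6 ρ)` is within `1 / 2560` of the origin
  obtain ⟨ρ, hρ⟩ : ∃ ρ : ℝ, ρ = 1 / 17920 := ⟨_, rfl⟩
  have hρ0 : 0 < ρ := by rw [hρ]; norm_num
  refine ⟨ρ ^ 2 / 10 ^ 14, by positivity, by rw [hρ]; norm_num, ?_⟩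
  intro n μ _ h hμ e₁ e₂ he₁ he₂ he σ hσ hσ1
  set κ : ℝ := ρ ^ 2 / 10 ^ 14 * σ with hκ
  have hκ0 : 0 < κ := by positivity
  set L : Set (ℝ × ℝ) := {z : ℝ × ℝ | κ ≤
    μ.real {x | |inner ℝ e₁ x - z.1| ≤ σ * ρ ∧ |inner ℝ e₂ x - z.2| ≤ ρ}} with hL
  have hLc : Convex ℝ L := hμ.convex_heavy_cells (by norm_num) e₁ e₂ _ _ _
  have hσρ : 0 < σ * ρ := by positivity
  -- the cell centred at `(2 σ ρ, -6 ρ)`, and all cells close to it, lie in the wedge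
  by_cases hz : ((2 * (σ * ρ), -(6 * ρ)) : ℝ × ℝ) ∈ closure L
  · obtain ⟨z, hzL, hzd⟩ := Metric.mem_closure_iff.1 hz (σ * ρ / 2) (by positivity)
    refine le_trans hzL (measureReal_mono fun x hx => ?_)
    rw [Prod.dist_eq, max_lt_iff, Real.dist_eq, Real.dist_eq, abs_lt, abs_lt] at hzd
    have hσρ' : σ * ρ ≤ ρ := by nlinarith
    obtain ⟨⟨h1, h2⟩, h3, h4⟩ := hzd
    obtain ⟨h5, h6⟩ := hx
    rw [abs_le] at h5 h6
    simp only at h1 h2 h3 h4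
    have hp : 0 < inner ℝ e₁ x := by linarith
    have hq : inner ℝ e₂ x < -(4 * ρ) := by linarith
    refine ⟨mul_neg_of_pos_of_neg hp (by linarith), ?_⟩
    rw [abs_of_pos hp, abs_of_neg (by linarith)]
    have : σ * (4 * ρ) ≤ σ * -inner ℝ e₂ x := by gcongr; linarith
    linarith
  · exfalso
    -- a halfspace separating the target from the heavy cells contains centres of light cells only
    have hdir : ∃ e : EuclideanSpace ℝ (Fin n), ‖e‖ = 1 ∧ ∀ x, 1 / 2560 < inner ℝ e x →
        (inner ℝ e₁ x, inner ℝ e₂ x) ∉ L := by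
      obtain ⟨f, u, hfu, huf⟩ := geometric_hahn_banach_closed_point hLc.closure isClosed_closure hz
      have hf : ∀ s t : ℝ, f (s, t) = s * f (1, 0) + t * f (0, 1) := fun s t => by
        have : ((s, t) : ℝ × ℝ) = s • (1, 0) + t • (0, 1) := by ext <;> simp
        rw [this, map_add, map_smul, map_smul, smul_eq_mul, smul_eq_mul]
      rw [hf] at huf
      set c₁ := f (1, 0)
      set c₂ := f (0, 1)
      set v : EuclideanSpace ℝ (Fin n) := c₁ • e₁ + c₂ • e₂ with hv
      have hvx : ∀ x, inner ℝ v x = c₁ * inner ℝ e₁ x + c₂ * inner ℝ e₂ x := fun x => by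
        rw [hv, inner_add_left, real_inner_smul_left, real_inner_smul_left]
      have he' : inner ℝ e₂ e₁ = 0 := by rw [real_inner_comm, he]
      have hvn : ‖v‖ ^ 2 = c₁ ^ 2 + c₂ ^ 2 := by
        rw [← real_inner_self_eq_norm_sq, hvx, hv, inner_add_right, inner_add_right,
          real_inner_smul_right, real_inner_smul_right, real_inner_smul_right,
          real_inner_smul_right, he, he', real_inner_self_eq_norm_sq, real_inner_self_eq_norm_sq,
          he₁, he₂]
        ring
      have hbound : 2 * (σ * ρ) * c₁ + -(6 * ρ) * c₂ ≤ ‖v‖ * (1 / 2560) := by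
        have h1 : (2 * σ * c₁ - 6 * c₂) ^ 2 ≤ (7 * ‖v‖) ^ 2 := by
          rw [mul_pow, hvn]
          have : σ ^ 2 ≤ 1 := by nlinarith
          nlinarith [sq_nonneg (6 * c₁ + 2 * σ * c₂), sq_nonneg c₁, sq_nonneg c₂]
        have h2 := abs_le_of_sq_le_sq h1 (by positivity)
        have h3 := mul_le_mul_of_nonneg_left ((le_abs_self _).trans h2) hρ0.le
        rw [hρ] at h3 ⊢
        linarith
      -- `v = 0` only happens if there is no heavy cell at all
      rcases eq_or_ne v 0 with hv0 | hv0
      · refine ⟨e₁, he₁, fun x _ hxL => ?_⟩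
        have h1 := hfu _ (subset_closure hxL)
        rw [hf] at h1
        have h2 := hvx x
        rw [hv0, inner_zero_left] at h2
        rw [hv0, norm_zero, zero_mul] at hbound
        linarith
      · have hvp : 0 < ‖v‖ := norm_pos_iff.2 hv0
        refine ⟨‖v‖⁻¹ • v, norm_smul_inv_norm hv0, fun x hx hxL => ?_⟩
        have h1 := hfu _ (subset_closure hxL)
        rw [hf] at h1
        rw [real_inner_smul_left, ← div_eq_inv_mul, lt_div_iff₀ hvp] at hx
        have h2 := hvx x
        linarith
    obtain ⟨e, hen, heL⟩ := hdir
    -- a grid of light cells covers the part of that halfspace where `|⟪e₁, x⟫|, |⟪e₂, x⟫| ≤ 2000`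
    set S : Set (EuclideanSpace ℝ (Fin n)) :=
      {x | 1 / 2560 < inner ℝ e x ∧ |inner ℝ e₁ x| ≤ 2000 ∧ |inner ℝ e₂ x| ≤ 2000} with hS
    have h1 : 1 / 10 ^ 6 ≤ μ.real S + (1 / 2000 ^ 2 + 1 / 2000 ^ 2) := by
      refine (h.measureReal_inner_gt_ge hμ hen).trans ?_
      refine le_trans ?_ (add_le_add_right (add_le_add
        (h.measureReal_inner_gt_le he₁ (T := 2000) (by norm_num))
        (h.measureReal_inner_gt_le he₂ (T := 2000) (by norm_num))) _)
      refine le_trans ?_ (add_le_add_right (measureReal_union_le _ _) _)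
      refine (measureReal_mono fun x hx => ?_).trans (measureReal_union_le _ _)
      rcases le_or_gt |inner ℝ e₁ x| 2000 with h2 | h2
      · rcases le_or_gt |inner ℝ e₂ x| 2000 with h3 | h3
        · exact Or.inl ⟨hx, h2, h3⟩
        · exact Or.inr (Or.inr h3)
      · exact Or.inr (Or.inl h2)
    have hρ1 : ρ ≤ 1 := by rw [hρ]; norm_num
    have hσρ1 : σ * ρ ≤ 1 := by nlinarith
    have h2 : μ.real S ≤ ((Finset.Icc ⌊-2000 / (σ * ρ)⌋ ⌊2000 / (σ * ρ)⌋) ×ˢ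
        (Finset.Icc ⌊-2000 / ρ⌋ ⌊2000 / ρ⌋)).card * κ := by
      refine measureReal_le_card_mul
        (fun x => (⌊inner ℝ e₁ x / (σ * ρ)⌋, ⌊inner ℝ e₂ x / ρ⌋)) _ hκ0.le ?_ ?_
      · intro x hx
        exact Finset.mk_mem_product (floor_div_mem_Icc hσρ hx.2.1) (floor_div_mem_Icc hρ0 hx.2.2)
      · intro x hx
        refine le_trans (measureReal_mono ?_) (not_le.1 (heL x hx.1)).le
        rintro y ⟨-, hyx⟩
        rw [Prod.mk.injEq] at hyx
        exact ⟨abs_sub_le_of_floor_div_eq hσρ hyx.1, abs_sub_le_of_floor_div_eq hρ0 hyx.2⟩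
    have h3 := card_Icc_floor_le (T := 2000) (by norm_num) hσρ hσρ1
    have h4 := card_Icc_floor_le (T := 2000) (by norm_num) hρ0 hρ1
    have h5 : μ.real S ≤ (2 * 2000 + 2) / (σ * ρ) * ((2 * 2000 + 2) / ρ) * κ := by
      refine h2.trans ?_
      rw [Finset.card_product, Nat.cast_mul]
      gcongr
    have h6 : (2 * 2000 + 2) / (σ * ρ) * ((2 * 2000 + 2) / ρ) * κ = 4002 ^ 2 / 10 ^ 14 := by
      rw [hκ]
      field_simp
      norm_num
    rw [h6] at h5
    norm_num at h1 h5
    linarith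

end

/-! ### Disagreement and angles -/

section

variable {n : ℕ} {μ : Measure (EuclideanSpace ℝ (Fin n))}

lemma inner_sq_add_inner_sq_le {e₁ e₂ : EuclideanSpace ℝ (Fin n)} (he₁ : ‖e₁‖ = 1)
    (he₂ : ‖e₂‖ = 1) (he : inner ℝ e₁ e₂ = 0) (x : EuclideanSpace ℝ (Fin n)) :
    inner ℝ e₁ x ^ 2 + inner ℝ e₂ x ^ 2 ≤ ‖x‖ ^ 2 := by
  have ho : Orthonormal ℝ ![e₁, e₂] := by
    rw [orthonormal_vecCons_iff]
    refine ⟨he₁, fun i => ?_, ?_⟩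
    · simpa using he
    · exact ⟨fun i => by simpa using he₂, fun i j hij => absurd (Subsingleton.elim i j) hij⟩
  simpa [Fin.sum_univ_two] using ho.sum_inner_products_le x (s := Finset.univ)

/-- The disagreement probability of two halfspaces dominates the sine of their angle, and the sine
bounds `|⟪w, x⟫| / ‖x‖` at every point `x` on which the two halfspaces disagree. For an obtuse angle
the sine is replaced by `1`. -/
lemma exists_abs_inner_le_halfspaceDist_of_norm_eq_one : ∃ c : ℝ, 0 < c ∧ ∀ (n : ℕ)
    (μ : Measure (EuclideanSpace ℝ (Fin n))), IsProbabilityMeasure μ → Isotropic μ →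
    BrunnMinkowskiMeasure 4 μ → ∀ u w x : EuclideanSpace ℝ (Fin n), ‖u‖ = 1 → ‖w‖ = 1 →
    inner ℝ u x * inner ℝ w x ≤ 0 → c * |inner ℝ w x| ≤ ‖x‖ * halfspaceDist μ u w := by
  obtain ⟨c₀, hc₀, hc₀', hwedge⟩ := exists_wedge_measureReal_ge
  refine ⟨c₀, hc₀, fun n μ _ h hμ u w x hu hw hx => ?_⟩
  have hwx : |inner ℝ w x| ≤ ‖x‖ := by simpa [hw] using abs_real_inner_le_norm w x
  -- it suffices to bound the distance from below by `c₀ τ`, with `|⟪w, x⟫| ≤ τ ‖x‖`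
  have hsuff : ∀ τ : ℝ, |inner ℝ w x| ≤ τ * ‖x‖ → c₀ * τ ≤ halfspaceDist μ u w →
      c₀ * |inner ℝ w x| ≤ ‖x‖ * halfspaceDist μ u w := fun τ h1 h2 => by
    calc c₀ * |inner ℝ w x| ≤ c₀ * (τ * ‖x‖) := by gcongr
      _ = ‖x‖ * (c₀ * τ) := by ring
      _ ≤ _ := by gcongr
  set c := inner ℝ u w with hc
  set z := u - c • w with hz
  have huz : u = c • w + z := by rw [hz]; abel
  have hwz : inner ℝ w z = 0 := by
    rw [hz, inner_sub_right, real_inner_smul_right, real_inner_self_eq_norm_sq, hw,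
      real_inner_comm, ← hc]
    ring
  have hzn : c ^ 2 + ‖z‖ ^ 2 = 1 := by
    have h1 : ‖z‖ ^ 2 = 1 - c ^ 2 := by
      rw [hz, norm_sub_sq_real, real_inner_smul_right, norm_smul, hu, hw, ← hc, mul_one,
        Real.norm_eq_abs, sq_abs]
      ring
    rw [h1]; ring
  rcases eq_or_ne z 0 with hz0 | hz0
  · rw [hz0, add_zero] at huz
    have hux : ∀ y, inner ℝ u y = c * inner ℝ w y := fun y => by
      rw [huz, real_inner_smul_left]
    rw [hz0, norm_zero] at hzn
    rcases lt_or_ge c 0 with hc0 | hc0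
    · refine hsuff 1 (by simpa using hwx) ?_
      rw [mul_one]
      refine hc₀'.trans ((h.measureReal_inner_gt_ge hμ hw).trans (measureReal_mono fun y hy => ?_))
      have hy' : 1 / 2560 < inner ℝ w y := hy
      have hy0 : 0 < inner ℝ w y := lt_trans (by norm_num) hy'
      show inner ℝ u y * inner ℝ w y < 0
      rw [hux, mul_assoc]
      exact mul_neg_of_neg_of_pos hc0 (by positivity)
    · have hc1 : c = 1 := by nlinarith
      rw [hux, hc1, one_mul] at hx
      have : inner ℝ w x = 0 := by nlinarith
      rw [this, abs_zero, mul_zero]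
      exact mul_nonneg (norm_nonneg _) measureReal_nonneg
  · set σ := ‖z‖ with hσ
    have hσ0 : 0 < σ := norm_pos_iff.2 hz0
    have hσ1 : σ ≤ 1 := by nlinarith [sq_nonneg c]
    have hc1 : c ≤ 1 := by nlinarith [sq_nonneg σ]
    set v := σ⁻¹ • z with hv
    have hvn : ‖v‖ = 1 := norm_smul_inv_norm hz0
    have hwv : inner ℝ w v = 0 := by rw [hv, real_inner_smul_right, hwz, mul_zero]
    have hux : ∀ y, inner ℝ u y = c * inner ℝ w y + σ * inner ℝ v y := fun y => by
      rw [hv, real_inner_smul_left, mul_inv_cancel_left₀ hσ0.ne', ← real_inner_smul_left,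
        ← inner_add_left, ← huz]
    rcases lt_or_ge c 0 with hc0 | hc0
    · refine hsuff 1 (by simpa using hwx) ?_
      refine (hwedge n μ inferInstance h hμ w v hw hvn hwv 1 one_pos le_rfl).trans
        (measureReal_mono fun y hy => ?_)
      obtain ⟨h1, -⟩ := hy
      show inner ℝ u y * inner ℝ w y < 0
      rw [hux]
      nlinarith [sq_nonneg (inner ℝ w y)]
    · refine hsuff σ ?_ ?_
      · have hB := inner_sq_add_inner_sq_le hw hvn hwv x
        rw [hux] at hx
        refine abs_le_of_sq_le_sq ?_ (mul_nonneg hσ0.le (norm_nonneg x))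
        set p := inner ℝ w x
        set q := inner ℝ v x
        have h1 : (c * p) ^ 2 ≤ (σ * q) ^ 2 := by
          rcases eq_or_ne p 0 with hp | hp
          · rw [hp, mul_zero, zero_pow two_ne_zero]; positivity
          · have h2 : c * |p| ≤ σ * |q| := by
              have h3 : c * |p| * |p| ≤ σ * |q| * |p| := by
                have h4 : -(p * q) ≤ |q| * |p| := by
                  rw [← abs_mul, mul_comm q p]; exact neg_le_abs _
                have h5 : |p| * |p| = p * p := abs_mul_abs_self p
                nlinarith
              exact le_of_mul_le_mul_right h3 (abs_pos.2 hp)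
            rw [← sq_abs (c * p), ← sq_abs (σ * q), abs_mul, abs_mul, abs_of_nonneg hc0,
              abs_of_pos hσ0]
            gcongr
        rw [mul_pow] at h1 ⊢
        nlinarith [sq_nonneg σ]
      · refine (hwedge n μ inferInstance h hμ w v hw hvn hwv σ hσ0 hσ1).trans
          (measureReal_mono fun y hy => ?_)
        obtain ⟨h1, h2⟩ := hy
        show inner ℝ u y * inner ℝ w y < 0
        rw [hux]
        set p := inner ℝ w y
        set q := inner ℝ v y
        have hp : 0 < |p| := abs_pos.2 (left_ne_zero_of_mul h1.ne)
        have h3 : |p| * |q| = -(p * q) := by rw [← abs_mul, abs_of_neg h1]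
        have h4 : |p| * |p| = p * p := abs_mul_abs_self p
        have h5 : |p| * |p| < |p| * (σ * |q|) := by gcongr
        nlinarith [mul_nonneg (sub_nonneg.2 hc1) (mul_self_nonneg p)]

lemma halfspaceDist_smul_left {k : ℝ} (hk : 0 < k) (u w : EuclideanSpace ℝ (Fin n)) :
    halfspaceDist μ (k • u) w = halfspaceDist μ u w := by
  unfold halfspaceDist
  congr 1
  ext y
  simp only [Set.mem_ofPred_eq]
  rw [real_inner_smul_left, mul_assoc, mul_neg_iff]
  simp [hk, not_lt.2 hk.le]

lemma halfspaceDist_comm (u w : EuclideanSpace ℝ (Fin n)) :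
    halfspaceDist μ u w = halfspaceDist μ w u := by
  simp only [halfspaceDist, mul_comm]

lemma disagreementCoefficient_smul {k : ℝ} (hk : 0 < k) (w : EuclideanSpace ℝ (Fin n)) (ε : ℝ) :
    disagreementCoefficient μ (k • w) ε = disagreementCoefficient μ w ε := by
  have : ∀ u, halfspaceDist μ u (k • w) = halfspaceDist μ u w := fun u => by
    rw [halfspaceDist_comm, halfspaceDist_smul_left hk, halfspaceDist_comm]
  simp only [disagreementCoefficient, alexanderCapacity, halfspaceBall, this]

lemma exists_abs_inner_le_halfspaceDist : ∃ c : ℝ, 0 < c ∧ ∀ (n : ℕ)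
    (μ : Measure (EuclideanSpace ℝ (Fin n))), IsProbabilityMeasure μ → Isotropic μ →
    BrunnMinkowskiMeasure 4 μ → ∀ u w x : EuclideanSpace ℝ (Fin n), u ≠ 0 → ‖w‖ = 1 →
    inner ℝ u x * inner ℝ w x ≤ 0 → c * |inner ℝ w x| ≤ ‖x‖ * halfspaceDist μ u w := by
  obtain ⟨c₀, hc₀, key⟩ := exists_abs_inner_le_halfspaceDist_of_norm_eq_one
  refine ⟨c₀, hc₀, fun n μ hμp h hμ u w x hu hw hx => ?_⟩
  have hu0 : 0 < ‖u‖⁻¹ := inv_pos.2 (norm_pos_iff.2 hu)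
  have h1 := key n μ hμp h hμ (‖u‖⁻¹ • u) w x (norm_smul_inv_norm hu) hw (by
    rw [real_inner_smul_left, mul_assoc]
    exact mul_nonpos_of_nonneg_of_nonpos hu0.le hx)
  rwa [halfspaceDist_smul_left hu0] at h1

/-- A point of the disagreement region is classified differently from `w` by some halfspace of the
ball. -/
lemma exists_mem_halfspaceBall_of_mem_disagreementRegion {w x : EuclideanSpace ℝ (Fin n)} {r : ℝ}
    (hx : x ∈ disagreementRegion (halfspaceBall μ w r)) :
    ∃ u ∈ halfspaceBall μ w r, inner ℝ u x * inner ℝ w x ≤ 0 := by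
  obtain ⟨u, hu, v, hv, huv⟩ := hx
  by_contra! hcon
  have h1 := hcon u hu
  have h2 := hcon v hv
  nlinarith [mul_pos h1 h2, sq_nonneg (inner ℝ w x : ℝ)]

/-- The disagreement region of a ball of radius `r` lies in the union of the exterior of a ball of
radius `O(√n)` times the tail quantile, and of a slab of width `O(r √n)` times that quantile. -/
lemma exists_disagreementCoefficient_le : ∃ A : ℝ, 0 < A ∧ ∀ (n : ℕ), n ≠ 0 →
    ∀ (μ : Measure (EuclideanSpace ℝ (Fin n))), IsProbabilityMeasure μ → Isotropic μ →
    ∀ D : ℝ, 4 ≤ D → BrunnMinkowskiMeasure D μ → ∀ w : EuclideanSpace ℝ (Fin n), w ≠ 0 →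
    ∀ ε : ℝ, 0 < ε → ε < 1 → disagreementCoefficient μ w ε ≤
      ENNReal.ofReal (1 + A * (√n * (1 + 2 * (D * (ε ^ (-D⁻¹) - 1))))) := by
  obtain ⟨c₀, hc₀, hang⟩ := exists_abs_inner_le_halfspaceDist
  obtain ⟨C, hC, hslab⟩ := exists_slab_measureReal_le
  refine ⟨C * 2 / c₀, by positivity, ?_⟩
  intro n hn μ _ h D hD hμ w hw ε hε hε1
  have hw0 : 0 < ‖w‖⁻¹ := inv_pos.2 (norm_pos_iff.2 hw)
  rw [← disagreementCoefficient_smul hw0]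
  have hw1 : ‖‖w‖⁻¹ • w‖ = 1 := norm_smul_inv_norm hw
  generalize ‖w‖⁻¹ • w = e at hw1
  have hD0 : 0 < D := by linarith
  have hμ4 := hμ.of_le (by norm_num) hD
  have hsn : 0 < √(n : ℝ) := Real.sqrt_pos.2 (by exact_mod_cast Nat.pos_of_ne_zero hn)
  have hεD : 1 < ε ^ (-D⁻¹) :=
    Real.one_lt_rpow_of_pos_of_lt_one_of_neg hε hε1 (neg_lt_zero.2 (inv_pos.2 hD0))
  set t : ℝ := 1 + 2 * (D * (ε ^ (-D⁻¹) - 1)) with ht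
  have ht1 : 1 < t := by
    have : 0 < D * (ε ^ (-D⁻¹) - 1) := mul_pos hD0 (by linarith)
    linarith
  have htail : μ.real {x | t * (2 * √n) < ‖x‖} ≤ ε := by
    have h1 := hμ.seminorm_tail_le hD0 (normSeminorm ℝ _) measurable_norm
      (h.measureReal_norm_le_ge hn) ht1
    refine h1.trans ?_
    have h2 : ε ^ (-D⁻¹) ≤ 1 + t / (2 * D) := by
      have : t / (2 * D) = 1 / (2 * D) + (ε ^ (-D⁻¹) - 1) := by rw [ht]; field_simp
      rw [this]
      have : 0 < 1 / (2 * D) := by positivity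
      linarith
    have h3 := Real.rpow_le_rpow_of_nonpos (z := -D) (by linarith) h2 (by linarith)
    rwa [← Real.rpow_mul hε.le, neg_mul_neg, inv_mul_cancel₀ hD0.ne', Real.rpow_one] at h3
  refine iSup₂_le fun r hr => ?_
  have hr0 : 0 < r := hε.trans_le hr
  have hb : 0 < r / c₀ * (t * (2 * √n)) := by positivity
  have hsub : disagreementRegion (halfspaceBall μ e r) ⊆
      {x | t * (2 * √n) < ‖x‖} ∪ {x | |inner ℝ e x| ≤ r / c₀ * (t * (2 * √n))} := by
    intro x hx
    obtain ⟨u, hu, hux⟩ := exists_mem_halfspaceBall_of_mem_disagreementRegion hx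
    rcases lt_or_ge (t * (2 * √n)) ‖x‖ with h1 | h1
    · exact Or.inl h1
    · refine Or.inr ?_
      have h2 := hang n μ inferInstance h hμ4 u e x hu.1 hw1 hux
      have h3 : ‖x‖ * halfspaceDist μ u e ≤ t * (2 * √n) * r :=
        mul_le_mul h1 hu.2 measureReal_nonneg (by positivity)
      show |inner ℝ e x| ≤ r / c₀ * (t * (2 * √n))
      rw [div_mul_eq_mul_div, le_div_iff₀ hc₀]
      linarith
  rw [alexanderCapacity, ENNReal.div_le_iff_le_mul (Or.inl (by simpa using hr0))
    (Or.inl ENNReal.ofReal_ne_top), ← ENNReal.ofReal_mul (by positivity), ← ofReal_measureReal]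
  refine ENNReal.ofReal_le_ofReal ((measureReal_mono hsub).trans
    ((measureReal_union_le _ _).trans ?_))
  have h4 := hslab n μ inferInstance h hμ4 e hw1 _ hb
  calc μ.real {x | t * (2 * √n) < ‖x‖} + μ.real {x | |inner ℝ e x| ≤ r / c₀ * (t * (2 * √n))}
      ≤ r + C * (r / c₀ * (t * (2 * √n))) := add_le_add (htail.trans hr) h4
    _ = _ := by ring

end

/-! ### Bounds for the constant `f₁` -/

/-- The parameters `α`, `β`, `γ` of the marginals stay away from the values at which the factors of
`f₁` degenerate, and each factor is then positive and at most `1` (the last one at most `1 / 9`). -/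
lemma f₁_pos_and_le {c s : ℝ} (hc : 0 < c) {n : ℕ} (hn : n ≠ 0)
    (hs : -(1 / (2 * (n : ℝ) + 3)) ≤ s) (hs0 : s < 0) : 0 < f₁ c s n ∧ f₁ c s n ≤ c / 9 := by
  have hn1 : (1 : ℝ) ≤ n := by exact_mod_cast Nat.one_le_iff_ne_zero.2 hn
  have hsn : -1 ≤ s * (2 * n + 3) := by
    rw [neg_le, one_div, le_inv_comm₀ (by linarith) (by positivity), ← one_div,
      div_eq_mul_inv, one_mul] at hs
    have h1 := mul_le_mul_of_nonneg_left hs (by linarith : 0 ≤ -s)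
    rw [mul_inv_cancel₀ (by linarith)] at h1
    linarith
  have hs4 : -1 ≤ s * (n + 4) := by nlinarith
  have hα0 : 0 < 1 + ((n : ℝ) - 2) * s := by nlinarith
  have hβ0 : 0 < 1 + ((n : ℝ) - 1) * s := by nlinarith
  have hγ0 : 0 < 1 + (n : ℝ) * s := by nlinarith
  rw [f₁]
  set α : ℝ := s / (1 + ((n : ℝ) - 2) * s) with hα
  set β : ℝ := s / (1 + ((n : ℝ) - 1) * s) with hβ
  set γ : ℝ := s / (1 + (n : ℝ) * s) with hγ
  have α0 : α < 0 := div_neg_of_neg_of_pos hs0 hα0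
  have β0 : β < 0 := div_neg_of_neg_of_pos hs0 hβ0
  have γ0 : γ < 0 := div_neg_of_neg_of_pos hs0 hγ0
  have α1 : -(1 / 6) ≤ α := by rw [hα, le_div_iff₀ hα0]; linarith
  have β1 : -(1 / 5) ≤ β := by rw [hβ, le_div_iff₀ hβ0]; linarith
  have γ1 : -(1 / 4) ≤ γ := by rw [hγ, le_div_iff₀ hγ0]; linarith
  clear_value α β γ
  have hαinv : 0 < -(1 / α) := by rw [neg_pos]; exact one_div_neg.2 α0
  -- `2 ^ (-3 α)` lies between `1` and `√2`
  have a1 : (2 : ℝ) ^ (-3 * α) < 2 := by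
    conv_rhs => rw [← Real.rpow_one 2]
    exact Real.rpow_lt_rpow_of_exponent_lt one_lt_two (by linarith)
  have a2 : 1 ≤ (2 : ℝ) ^ (-3 * α) := Real.one_le_rpow one_le_two (by linarith)
  have A1 : 0 < (2 - (2 : ℝ) ^ (-3 * α)) ^ (-(1 / α)) := Real.rpow_pos_of_pos (by linarith) _
  have A2 : (2 - (2 : ℝ) ^ (-3 * α)) ^ (-(1 / α)) ≤ 1 :=
    Real.rpow_le_one (by linarith) (by linarith) hαinv.le
  -- the base of the second factor is `2 (2 Y Z) ^ α - 1`; it is positive as `2 Y Z < 64 = 2 ^ 6`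
  -- and `-1 / 6 ≤ α`
  set Y : ℝ := (1 + β) / (1 + 3 * β) with hY
  have Y1 : 1 ≤ Y := by rw [hY, one_le_div (by linarith)]; linarith
  have Y2 : Y ≤ 2 := by rw [hY, div_le_iff₀ (by linarith)]; linarith
  set Z : ℝ := √(3 * (1 + γ) ^ (3 / γ)) with hZ
  have z1 : 1 ≤ (1 + γ) ^ (3 / γ) :=
    Real.one_le_rpow_of_pos_of_le_one_of_nonpos (by linarith) (by linarith)
      (div_nonpos_of_nonneg_of_nonpos (by norm_num) γ0.le)
  have z2 : (1 + γ) ^ (3 / γ) ≤ (4 / 3) ^ 12 := by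
    have h1 : ((3 / 4 : ℝ)) ^ (-4 * γ) ≤ 1 + γ := by
      have := rpow_one_add_le_one_add_mul_self (s := -1 / 4) (p := -4 * γ) (by norm_num)
        (by linarith) (by linarith)
      rw [show (1 : ℝ) + -1 / 4 = 3 / 4 by norm_num] at this
      linarith
    have h2 := Real.rpow_le_rpow_of_nonpos (z := 3 / γ) (by positivity) h1
      (div_nonpos_of_nonneg_of_nonpos (by norm_num) γ0.le)
    rw [← Real.rpow_mul (by norm_num)] at h2
    have h3 : -4 * γ * (3 / γ) = -((12 : ℕ) : ℝ) := by
      have := γ0.ne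
      field_simp
      norm_num
    rw [h3, Real.rpow_neg (by norm_num), Real.rpow_natCast, ← inv_pow] at h2
    refine h2.trans (le_of_eq ?_)
    norm_num
  have Z1 : 1 ≤ Z := by rw [hZ, Real.one_le_sqrt]; linarith
  have Z2 : Z < 16 := by
    rw [hZ, Real.sqrt_lt' (by norm_num)]
    have : (3 : ℝ) * (4 / 3) ^ 12 < 16 ^ 2 := by norm_num
    linarith
  have e1 : (Y * Z * (2 : ℝ) ^ (1 + 1 / α)) ^ α = 2 * (2 * (Y * Z)) ^ α := by
    rw [Real.mul_rpow (by positivity) (by positivity), ← Real.rpow_mul (by norm_num), add_mul,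
      one_mul, one_div_mul_cancel α0.ne, Real.rpow_add (by norm_num), Real.rpow_one,
      Real.mul_rpow (x := 2) (by norm_num) (by positivity)]
    ring
  have YZ1 : 1 ≤ 2 * (Y * Z) := by nlinarith
  have YZ2 : 2 * (Y * Z) < 64 := by nlinarith
  have b1 : 1 / 2 < (2 * (Y * Z)) ^ α := by
    have h1 : (64 : ℝ) ^ (-(1 / 6) : ℝ) = 1 / 2 := by
      rw [show (64 : ℝ) = 2 ^ (6 : ℝ) by norm_num, ← Real.rpow_mul (by norm_num)]
      norm_num [Real.rpow_neg_one]
    have h2 : (64 : ℝ) ^ (-(1 / 6) : ℝ) ≤ 64 ^ α :=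
      Real.rpow_le_rpow_of_exponent_le (by norm_num) α1
    have h3 : (64 : ℝ) ^ α < (2 * (Y * Z)) ^ α :=
      Real.rpow_lt_rpow_of_neg (by linarith) YZ2 α0
    linarith
  have b2 : (2 * (Y * Z)) ^ α ≤ 1 := Real.rpow_le_one_of_one_le_of_nonpos YZ1 α0.le
  rw [e1]
  have B1 : 0 < (2 * (2 * (Y * Z)) ^ α - 1) ^ (-(1 / α)) := Real.rpow_pos_of_pos (by linarith) _
  have B2 : (2 * (2 * (Y * Z)) ^ α - 1) ^ (-(1 / α)) ≤ 1 :=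
    Real.rpow_le_one (by linarith) (by linarith) hαinv.le
  have C1 : 0 < (1 + γ) ^ (-(2 / γ)) := Real.rpow_pos_of_pos (by linarith) _
  have C2 : (1 + γ) ^ (-(2 / γ)) ≤ 1 := Real.rpow_le_one (by linarith) (by linarith)
    (by rw [neg_nonneg]; exact div_nonpos_of_nonneg_of_nonpos (by norm_num) γ0.le)
  have D0 : 0 < (1 + 3 * β) / (3 + 3 * β) := div_pos (by linarith) (by linarith)
  have D1 : 0 < ((1 + 3 * β) / (3 + 3 * β)) ^ 2 := by positivity
  have D2 : ((1 + 3 * β) / (3 + 3 * β)) ^ 2 ≤ 1 / 9 := by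
    have : (1 + 3 * β) / (3 + 3 * β) ≤ 1 / 3 := by
      rw [div_le_div_iff₀ (by linarith) (by norm_num)]; linarith
    nlinarith
  refine ⟨by positivity, ?_⟩
  calc _ ≤ c * 1 * 1 * 1 * (1 / 9) := by gcongr
    _ = c / 9 := by ring

/-- The target bound dominates its leading part, with `D = -(1 + n s) / s`. -/
lemma le_disagreementBound {c s : ℝ} (hc : 0 < c) {n : ℕ} (hn : n ≠ 0)
    (hs : -(1 / (2 * (n : ℝ) + 3)) ≤ s) (hs0 : s < 0) {ε : ℝ} (hε : 0 < ε) (hε1 : ε < 1) {D : ℝ}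
    (hD : D = -s⁻¹ - n) (hD0 : 0 < D) :
    √n * (D * (ε ^ (-D⁻¹) - 1)) ≤ c / 9 * disagreementBound c s n ε := by
  obtain ⟨hf0, hf1⟩ := f₁_pos_and_le hc hn hs hs0
  have hn1 : (1 : ℝ) ≤ n := by exact_mod_cast Nat.one_le_iff_ne_zero.2 hn
  have hsD : 1 + n * s = -s * D := by
    rw [hD]
    have := hs0.ne
    field_simp
    ring
  have h1 : 0 < 1 + n * s := by rw [hsD]; exact mul_pos (by linarith) hD0
  have h2 : s / (1 + n * s) = -D⁻¹ := by
    rw [hsD]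
    have := hs0.ne
    field_simp
  have h3 : 0 < 1 + (n + 2) * s := by
    have : -1 ≤ s * (2 * n + 3) := by
      have h4 := mul_le_mul_of_nonneg_right hs (by linarith : 0 ≤ 2 * (n : ℝ) + 3)
      rwa [neg_mul, one_div, inv_mul_cancel₀ (by linarith)] at h4
    nlinarith
  have hεD : 1 < ε ^ (-D⁻¹) :=
    Real.one_lt_rpow_of_pos_of_lt_one_of_neg hε hε1 (neg_lt_zero.2 (inv_pos.2 hD0))
  have e : c / 9 * disagreementBound c s n ε =
      √n * (D * (ε ^ (-D⁻¹) - 1)) * ((1 + n * s) / (1 + (n + 2) * s) * (c / 9 / f₁ c s n)) := by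
    rw [disagreementBound, h2]
    have hD' : D = (1 + n * s) / -s := by
      have := hs0.ne
      rw [hsD]
      field_simp
    generalize ε ^ (-D⁻¹) = E
    rw [hD']
    have := hs0.ne
    field_simp
    ring
  rw [e]
  refine le_mul_of_one_le_right ?_ ?_
  · have : 0 ≤ ε ^ (-D⁻¹) - 1 := by linarith
    positivity
  · refine one_le_mul_of_one_le_of_one_le ?_ ?_
    · rw [one_le_div h3]; nlinarith
    · rwa [one_le_div hf0]

lemma log_one_div_le {ε D : ℝ} (hε : 0 < ε) (hD : 0 < D) :
    Real.log (1 / ε) ≤ D * (ε ^ (-D⁻¹) - 1) := by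
  have h1 := Real.add_one_le_exp (Real.log ε * -D⁻¹)
  rw [← Real.rpow_def_of_pos hε] at h1
  have h2 : Real.log (1 / ε) = D * (Real.log ε * -D⁻¹) := by
    rw [one_div, Real.log_inv]
    field_simp
  rw [h2]
  gcongr
  linarith

lemma exists_disagreementCoefficient_le_disagreementBound {c : ℝ} (hc : 0 < c) {ε₀ : ℝ}
    (hε₀ : 0 < ε₀) (hε₀1 : ε₀ < 1) : ∃ C : ℝ, 0 < C ∧ ∀ (n : ℕ) (s : ℝ), n ≠ 0 →
      -(1 / (2 * (n : ℝ) + 3)) ≤ s → s < 0 →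
      ∀ μ : Measure (EuclideanSpace ℝ (Fin n)), IsProbabilityMeasure μ →
        SConcaveDistribution s μ → Isotropic μ →
        ∀ w : EuclideanSpace ℝ (Fin n), w ≠ 0 → ∀ ε : ℝ, 0 < ε → ε ≤ ε₀ →
          0 ≤ disagreementBound c s n ε ∧
          disagreementCoefficient μ w ε ≤ ENNReal.ofReal (C * disagreementBound c s n ε) := by
  obtain ⟨A, hA, key⟩ := exists_disagreementCoefficient_le
  set ℓ := Real.log (1 / ε₀) with hℓ
  have hℓ0 : 0 < ℓ := Real.log_pos (by rw [lt_div_iff₀ hε₀]; linarith)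
  refine ⟨(1 / ℓ + A / ℓ + 2 * A) * (c / 9), by positivity, ?_⟩
  intro n s hn hs hs0 μ hμp hμ h w hw ε hε hε'
  have hε1 : ε < 1 := by linarith
  have hn1 : (1 : ℝ) ≤ n := by exact_mod_cast Nat.one_le_iff_ne_zero.2 hn
  have hp : 2 * (n : ℝ) + 3 ≤ -s⁻¹ := by
    rw [neg_le] at hs
    rw [← inv_neg, le_inv_comm₀ (by positivity) (by linarith), ← one_div]
    exact hs
  obtain ⟨D, hD⟩ : ∃ D : ℝ, D = -s⁻¹ - n := ⟨_, rfl⟩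
  have hD4 : 4 ≤ D := by linarith
  have hsp : s = -(-s⁻¹)⁻¹ := by rw [inv_neg, inv_inv, neg_neg]
  have hBM : BrunnMinkowskiMeasure D μ := by
    rw [hsp] at hμ
    rw [hD]
    exact hμ.brunnMinkowskiMeasure (by linarith)
  have h1 := key n hn μ hμp h D hD4 hBM w hw ε hε hε1
  have h2 := le_disagreementBound hc hn hs hs0 hε hε1 hD (by linarith)
  have h3 : ℓ ≤ D * (ε ^ (-D⁻¹) - 1) := by
    refine le_trans ?_ (log_one_div_le hε (by linarith))
    exact Real.log_le_log (by positivity) (by gcongr)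
  set Q := D * (ε ^ (-D⁻¹) - 1)
  have hsn : 1 ≤ √(n : ℝ) := Real.one_le_sqrt.2 hn1
  have hQ : 0 < Q := hℓ0.trans_le h3
  have hB : 0 < c / 9 * disagreementBound c s n ε := lt_of_lt_of_le (by positivity) h2
  refine ⟨(pos_of_mul_pos_right hB (by positivity)).le, h1.trans (ENNReal.ofReal_le_ofReal ?_)⟩
  have h4 : 1 ≤ 1 / ℓ * (√n * Q) := by
    rw [one_div_mul_eq_div, one_le_div hℓ0]
    nlinarith
  have h5 : A * √n ≤ A / ℓ * (√n * Q) := by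
    rw [div_mul_eq_mul_div, le_div_iff₀ hℓ0]
    have := mul_le_mul_of_nonneg_left h3 (by positivity : 0 ≤ A * √(n : ℝ))
    linarith
  calc 1 + A * (√n * (1 + 2 * Q)) = 1 + A * √n + 2 * A * (√n * Q) := by ring
    _ ≤ 1 / ℓ * (√n * Q) + A / ℓ * (√n * Q) + 2 * A * (√n * Q) := by gcongr
    _ = (1 / ℓ + A / ℓ + 2 * A) * (√n * Q) := by ring
    _ ≤ (1 / ℓ + A / ℓ + 2 * A) * (c / 9 * disagreementBound c s n ε) := by gcongr
    _ = _ := by ring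

/-! ### The limit of the bound as `s → 0⁻` -/

/-- The limit `u ^ b → exp L` when `u → 1` and `(u - 1) b → L`. -/
lemma tendsto_rpow_of_tendsto_sub_one_mul {ι : Type*} {l : Filter ι} {u b : ι → ℝ} {L : ℝ}
    (hu : Tendsto u l (𝓝 1)) (h : Tendsto (fun x => (u x - 1) * b x) l (𝓝 L)) :
    Tendsto (fun x => u x ^ b x) l (𝓝 (Real.exp L)) := by
  have hd : DifferentiableAt ℝ Real.log 1 := Real.differentiableAt_log one_ne_zero
  have hdl : Tendsto (fun x => dslope Real.log 1 (u x)) l (𝓝 1) := by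
    have := (continuousAt_dslope_same.2 hd).tendsto.comp hu
    rw [dslope_same, Real.deriv_log, inv_one] at this
    exact this
  have hlog : ∀ y : ℝ, Real.log y = dslope Real.log 1 y * (y - 1) := fun y => by
    have := sub_smul_dslope Real.log 1 y
    rw [smul_eq_mul, Real.log_one, sub_zero] at this
    rw [← this, mul_comm]
  have h1 : Tendsto (fun x => Real.exp (dslope Real.log 1 (u x) * ((u x - 1) * b x))) l
      (𝓝 (Real.exp (1 * L))) := (Real.continuous_exp.tendsto _).comp (hdl.mul h)
  rw [one_mul] at h1
  refine h1.congr' ?_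
  filter_upwards [hu.eventually_const_lt one_pos] with x hx
  rw [Real.rpow_def_of_pos hx, hlog (u x), mul_assoc]

/-- The difference quotient of `x ↦ exp (k x)` at the origin along `a → 0`, with a varying rate
`k`. -/
lemma tendsto_exp_mul_sub_one_div {ι : Type*} {l : Filter ι} {a k : ι → ℝ} {K : ℝ}
    (ha : Tendsto a l (𝓝 0)) (ha0 : ∀ᶠ x in l, a x ≠ 0) (hk : Tendsto k l (𝓝 K)) :
    Tendsto (fun x => (Real.exp (a x * k x) - 1) / a x) l (𝓝 K) := by
  have hd : DifferentiableAt ℝ Real.exp 0 := Real.differentiableAt_exp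
  have hak : Tendsto (fun x => a x * k x) l (𝓝 0) := by simpa using ha.mul hk
  have hdl : Tendsto (fun x => dslope Real.exp 0 (a x * k x)) l (𝓝 1) := by
    have := (continuousAt_dslope_same.2 hd).tendsto.comp hak
    rw [dslope_same, Real.deriv_exp, Real.exp_zero] at this
    exact this
  have h1 := hdl.mul hk
  rw [one_mul] at h1
  refine h1.congr' ?_
  filter_upwards [ha0] with x hx
  have := sub_smul_dslope Real.exp 0 (a x * k x)
  rw [smul_eq_mul, Real.exp_zero, sub_zero] at this
  rw [← this]
  field_simp

lemma tendsto_div_one_add_mul (k : ℝ) :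
    Tendsto (fun s : ℝ => s / (1 + k * s)) (𝓝[<] 0) (𝓝 0) := by
  have : ContinuousAt (fun s : ℝ => s / (1 + k * s)) 0 := by
    refine ContinuousAt.div (by fun_prop) (by fun_prop) (by simp)
  simpa using this.tendsto.mono_left nhdsWithin_le_nhds

lemma eventually_div_one_add_mul_ne_zero (k : ℝ) :
    ∀ᶠ s : ℝ in 𝓝[<] 0, s / (1 + k * s) ≠ 0 := by
  have h1 : Tendsto (fun s : ℝ => 1 + k * s) (𝓝[<] 0) (𝓝 1) := by
    have : Continuous fun s : ℝ => 1 + k * s := by fun_prop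
    simpa using (this.tendsto 0).mono_left nhdsWithin_le_nhds
  filter_upwards [self_mem_nhdsWithin, h1.eventually_const_lt one_pos] with s hs hs1
  exact div_ne_zero (ne_of_lt hs) hs1.ne'

/-- The limit of the factors of `f₁` when its parameters `α`, `β`, `γ` tend to `0`. -/
lemma tendsto_f₁_factors (c : ℝ) {ι : Type*} {l : Filter ι} {α β γ : ι → ℝ}
    (hα : Tendsto α l (𝓝 0)) (hβ : Tendsto β l (𝓝 0)) (hγ : Tendsto γ l (𝓝 0))
    (hα0 : ∀ᶠ s in l, α s ≠ 0) (hγ0 : ∀ᶠ s in l, γ s ≠ 0) :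
    Tendsto (fun s => c * (2 - (2 : ℝ) ^ (-3 * α s)) ^ (-(1 / α s)) *
      (((1 + β s) / (1 + 3 * β s) * √(3 * (1 + γ s) ^ (3 / γ s)) * (2 : ℝ) ^ (1 + 1 / α s)) ^ α s
        - 1) ^ (-(1 / α s)) * (1 + γ s) ^ (-(2 / γ s)) * ((1 + 3 * β s) / (3 + 3 * β s)) ^ 2) l
      (𝓝 (c * Real.exp (Real.log 2 * -3) *
        Real.exp (-(2 * Real.log (2 * (1 * √(3 * Real.exp 3))))) * Real.exp (-2) *
        (1 / 3) ^ 2)) := by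
  set Z₀ : ℝ := √(3 * Real.exp 3) with hZ₀
  have hZ₀0 : 0 < Z₀ := Real.sqrt_pos.2 (by positivity)
  have hγ1 : Tendsto (fun s => 1 + γ s) l (𝓝 1) := by simpa using hγ.const_add 1
  have hγpow : ∀ k : ℝ, Tendsto (fun s => (1 + γ s) ^ (k / γ s)) l (𝓝 (Real.exp k)) := by
    intro k
    refine tendsto_rpow_of_tendsto_sub_one_mul hγ1 (tendsto_const_nhds.congr' ?_)
    filter_upwards [hγ0] with s hs
    field_simp
    ring_nf
  -- `2 - 2 ^ (-3 α) = 1 + 3 α log 2 + o(α)`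
  have h1 : Tendsto (fun s => (2 - (2 : ℝ) ^ (-3 * α s)) ^ (-(1 / α s))) l
      (𝓝 (Real.exp (Real.log 2 * -3))) := by
    have h2 : ∀ s, (2 : ℝ) ^ (-3 * α s) = Real.exp (α s * (Real.log 2 * -3)) := fun s => by
      rw [Real.rpow_def_of_pos two_pos]; ring_nf
    simp only [h2]
    have hexp : Tendsto (fun s => Real.exp (α s * (Real.log 2 * -3))) l (𝓝 1) := by
      have := (Real.continuous_exp.tendsto _).comp (hα.mul_const (Real.log 2 * -3))
      rw [zero_mul, Real.exp_zero] at this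
      exact this
    refine tendsto_rpow_of_tendsto_sub_one_mul ?_ ?_
    · have := hexp.const_sub 2
      rwa [show (2 : ℝ) - 1 = 1 by norm_num] at this
    · refine (tendsto_exp_mul_sub_one_div hα hα0
        (tendsto_const_nhds (x := Real.log 2 * -3))).congr fun s => ?_
      ring
  -- the base of the second factor is `2 (2 Y Z) ^ α - 1 = 1 + 2 α log (2 Y Z) + o(α)`
  have hYZ : Tendsto (fun s => 2 * ((1 + β s) / (1 + 3 * β s) * √(3 * (1 + γ s) ^ (3 / γ s))))
      l (𝓝 (2 * (1 * Z₀))) := by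
    refine Tendsto.const_mul _ (Tendsto.mul ?_ ?_)
    · have := (hβ.const_add 1).div ((hβ.const_mul 3).const_add 1) (by simp)
      rw [mul_zero, add_zero, div_one] at this
      exact this
    · exact (Real.continuous_sqrt.tendsto _).comp ((hγpow 3).const_mul 3)
  have hYZ0 : 0 < 2 * (1 * Z₀) := by positivity
  have hlog := hYZ.log hYZ0.ne'
  have h2 : Tendsto (fun s => (((1 + β s) / (1 + 3 * β s) * √(3 * (1 + γ s) ^ (3 / γ s)) *
      (2 : ℝ) ^ (1 + 1 / α s)) ^ α s - 1) ^ (-(1 / α s))) l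
      (𝓝 (Real.exp (-(2 * Real.log (2 * (1 * Z₀)))))) := by
    have hbase : (fun s => 2 * Real.exp (α s * Real.log (2 * ((1 + β s) / (1 + 3 * β s) *
        √(3 * (1 + γ s) ^ (3 / γ s))))) - 1) =ᶠ[l]
        fun s => ((1 + β s) / (1 + 3 * β s) * √(3 * (1 + γ s) ^ (3 / γ s)) *
          (2 : ℝ) ^ (1 + 1 / α s)) ^ α s - 1 := by
      filter_upwards [hYZ.eventually_const_lt hYZ0, hα0] with s hs hαs
      set X := (1 + β s) / (1 + 3 * β s) * √(3 * (1 + γ s) ^ (3 / γ s))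
      have hX : 0 < X := by linarith
      rw [Real.mul_rpow hX.le (by positivity), ← Real.rpow_mul (by norm_num), add_mul, one_mul,
        one_div_mul_cancel hαs, Real.rpow_add (by norm_num), Real.rpow_one, mul_comm (α s),
        ← Real.rpow_def_of_pos hs, Real.mul_rpow (x := 2) (by norm_num) hX.le]
      ring
    have hq := (tendsto_exp_mul_sub_one_div hα hα0 hlog).const_mul (-2)
    rw [neg_mul] at hq
    have hlim := tendsto_rpow_of_tendsto_sub_one_mul (b := fun s => -(1 / α s))
      (u := fun s => 2 * Real.exp (α s * Real.log (2 * ((1 + β s) / (1 + 3 * β s) *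
        √(3 * (1 + γ s) ^ (3 / γ s))))) - 1) ?_ (hq.congr fun s => by ring)
    · refine hlim.congr' ?_
      filter_upwards [hbase] with s hs
      rw [hs]
    · have h3 := (((Real.continuous_exp.tendsto _).comp (hα.mul hlog)).const_mul 2).sub_const 1
      rw [zero_mul, Real.exp_zero] at h3
      rw [show (2 : ℝ) * 1 - 1 = 1 by norm_num] at h3
      exact h3
  have h3 : Tendsto (fun s => (1 + γ s) ^ (-(2 / γ s))) l (𝓝 (Real.exp (-2))) := by
    simpa only [neg_div] using hγpow (-2)
  have h4 : Tendsto (fun s => ((1 + 3 * β s) / (3 + 3 * β s)) ^ 2) l (𝓝 ((1 / 3) ^ 2)) := by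
    have := (((hβ.const_mul 3).const_add 1).div ((hβ.const_mul 3).const_add 3) (by simp)).pow 2
    rw [mul_zero, add_zero, add_zero] at this
    exact this
  exact (((h1.const_mul c).mul h2).mul h3).mul h4

/-- The limit of `f₁` at `s = 0` does not depend on the dimension. -/
lemma exists_tendsto_f₁ {c : ℝ} (hc : 0 < c) : ∃ F : ℝ, 0 < F ∧ ∀ n : ℕ,
    Tendsto (fun s : ℝ => f₁ c s n) (𝓝[<] 0) (𝓝 F) :=
  ⟨_, by positivity, fun n => tendsto_f₁_factors c (tendsto_div_one_add_mul ((n : ℝ) - 2))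
    (tendsto_div_one_add_mul ((n : ℝ) - 1)) (tendsto_div_one_add_mul (n : ℝ))
    (eventually_div_one_add_mul_ne_zero ((n : ℝ) - 2))
    (eventually_div_one_add_mul_ne_zero (n : ℝ))⟩

/-- The limit of the bound at `s = 0`. -/
lemma exists_tendsto_disagreementBound {c : ℝ} (hc : 0 < c) :
    ∃ K : ℝ, 0 < K ∧ ∀ (n : ℕ) (ε : ℝ), 0 < ε → ε < 1 →
      Tendsto (fun s : ℝ => disagreementBound c s n ε) (𝓝[<] 0)
        (𝓝 (K * (Real.sqrt n * Real.log (1 / ε)))) := by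
  obtain ⟨F, hF, hf⟩ := exists_tendsto_f₁ hc
  refine ⟨1 / F, by positivity, fun n ε hε _ => ?_⟩
  have hγ := tendsto_div_one_add_mul (n : ℝ)
  have hγ0 := eventually_div_one_add_mul_ne_zero (n : ℝ)
  have hlin : ∀ k : ℝ, Tendsto (fun s : ℝ => 1 + k * s) (𝓝[<] 0) (𝓝 1) := fun k => by
    have : Continuous fun s : ℝ => 1 + k * s := by fun_prop
    simpa using (this.tendsto 0).mono_left nhdsWithin_le_nhds
  have h1 := tendsto_exp_mul_sub_one_div hγ hγ0 (tendsto_const_nhds (x := Real.log ε))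
  have h2 := (((((hlin n)).const_mul √(n : ℝ)).div ((hlin (n + 2)).mul (hf n))
    (by simpa using hF.ne')).mul h1).neg
  have e : -(√(n : ℝ) * 1 / (1 * F) * Real.log ε) = 1 / F * (√(n : ℝ) * Real.log (1 / ε)) := by
    rw [one_div ε, Real.log_inv]
    ring
  rw [e] at h2
  refine h2.congr' ?_
  filter_upwards [hγ0, self_mem_nhdsWithin, (hlin n).eventually_const_lt one_pos] with s hγs hs hns
  rw [disagreementBound, Real.rpow_def_of_pos hε, mul_comm (Real.log ε)]
  have hs0 : s ≠ 0 := ne_of_lt hs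
  generalize Real.exp (s / (1 + n * s) * Real.log ε) = E
  simp only [Pi.div_apply]
  rw [div_div_eq_mul_div]
  field_simp
  ring

theorem mainTheorem10 (c : ℝ) (hc : 0 < c) :
    (∀ ε₀ : ℝ, 0 < ε₀ → ε₀ < 1 → ∃ C : ℝ, 0 < C ∧
      (∀ (n : ℕ) (s : ℝ), -(1 / (2 * (n : ℝ) + 3)) ≤ s → s < 0 →
        ∀ μ : Measure (EuclideanSpace ℝ (Fin n)), IsProbabilityMeasure μ →
          SConcaveDistribution s μ → Isotropic μ →
          ∀ w : EuclideanSpace ℝ (Fin n), w ≠ 0 → ∀ ε : ℝ, 0 < ε → ε ≤ ε₀ →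
            disagreementCoefficient μ w ε ≤ ENNReal.ofReal (C * disagreementBound c s n ε)) ∧
      (∀ n : ℕ,
        ∀ μ : Measure (EuclideanSpace ℝ (Fin n)), IsProbabilityMeasure μ →
          SConcaveDistribution 0 μ → Isotropic μ →
          ∀ w : EuclideanSpace ℝ (Fin n), w ≠ 0 → ∀ ε : ℝ, 0 < ε → ε ≤ ε₀ →
            disagreementCoefficient μ w ε
              ≤ ENNReal.ofReal (C * (Real.sqrt n * Real.log (1 / ε))))) ∧
    (∃ K : ℝ, 0 < K ∧ ∀ (n : ℕ) (ε : ℝ), 0 < ε → ε < 1 →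
      Tendsto (fun s : ℝ => disagreementBound c s n ε) (𝓝[<] 0)
        (𝓝 (K * (Real.sqrt n * Real.log (1 / ε))))) := by
  obtain ⟨K, hK, hlim⟩ := exists_tendsto_disagreementBound hc
  refine ⟨fun ε₀ hε₀ hε₀1 => ?_, K, hK, hlim⟩
  obtain ⟨C, hC, key⟩ := exists_disagreementCoefficient_le_disagreementBound hc hε₀ hε₀1
  have hn : ∀ {n : ℕ} {w : EuclideanSpace ℝ (Fin n)}, w ≠ 0 → n ≠ 0 := by
    rintro n w hw rfl
    exact hw (Subsingleton.elim _ _)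
  refine ⟨C * (1 + K), by positivity, ?_, ?_⟩
  · intro n s hs hs0 μ hμp hμ h w hw ε hε hε'
    obtain ⟨hB, hle⟩ := key n s (hn hw) hs hs0 μ hμp hμ h w hw ε hε hε'
    refine hle.trans (ENNReal.ofReal_le_ofReal ?_)
    gcongr
    nlinarith
  · -- a log-concave distribution is `s`-concave for every `s < 0`; let `s → 0⁻`
    intro n μ hμp hμ h w hw ε hε hε'
    have hε1 : ε < 1 := by linarith
    have hlog : 0 ≤ Real.log (1 / ε) := Real.log_nonneg (by rw [le_div_iff₀ hε]; linarith)
    have h1 : disagreementCoefficient μ w ε ≤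
        ENNReal.ofReal (C * (K * (√n * Real.log (1 / ε)))) := by
      refine ge_of_tendsto ((ENNReal.continuous_ofReal.tendsto _).comp
        ((hlim n ε hε hε1).const_mul C)) ?_
      have hneg : -(1 / (2 * (n : ℝ) + 3)) < 0 := neg_lt_zero.2 (by positivity)
      filter_upwards [self_mem_nhdsWithin, nhdsWithin_le_nhds (Ioi_mem_nhds hneg)] with s hs0 hs
      exact (key n s (hn hw) (le_of_lt hs) hs0 μ hμp (hμ.of_zero hs0) h w hw ε hε hε').2
    refine h1.trans (ENNReal.ofReal_le_ofReal ?_)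
    rw [← mul_assoc]
    gcongr
    linarith
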